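/- **Theorem (discrete orthogonality of $S^s$- and $S^l$-functions).** Let $\Delta=\{\alpha_1,\dots,\alpha_n\}$ be the simple roots of an irreducible reduced crystallographic root system with two different root lengths (i.e. of type $B_n$ $(n\ge 3)$, $C_n$ $(n\ge 2)$, $G_2$ or $F_4$), spanning a Euclidean space $\mathbb{R}^n$ with scalar product $\langle\cdot,\cdot\rangle$. Let $\Delta_s$, $\Delta_l$ be the sets of short and long simple roots, $W$ the Weyl group, $r_\alpha$ the reflection in $\alpha$, $\alpha^\vee=2\alpha/\langle\alpha,\alpha\rangle$, $c$ the determinant of the Cartan matrix, $Q=\sum\mathbb{Z}\alpha_i$, $Q^\vee=\sum\mathbb{Z}\alpha_i^\vee$, and let $P^\vee$ and $P$ be the $\mathbb{Z}$-duals of $Q$ and of $Q^\vee$. Let $\xi$ be the highest root and $\eta$ the highest dual root (the highest root of the system of the $\alpha^\vee$), and put $$F=\{a\in\mathbb{R}^n:\langle\alpha_i,a\rangle\ge 0\ (1\le i\le n),\ \langle\xi,a\rangle\le 1\},\qquad F^\vee=\{a\in\mathbb{R}^n:\langle\alpha_i^\vee,a\rangle\ge 0\ (1\le i\le n),\ \langle\eta,a\rangle\le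 1\}.$$ The affine Weyl group $W^{\mathrm{aff}}=Q^\vee\rtimes W$ and the dual affine Weyl group $\widehat W^{\mathrm{aff}}=Q\rtimes W$ act on $\mathbb{R}^n$ by $a\mapsto wa+q$; let $\psi$, $\widehat\psi$ be their retractions onto $W$. Let $\sigma^s,\sigma^l:W\to\{\pm1\}$ be the homomorphisms with $\sigma^s(r_\alpha)=-1$, $\sigma^l(r_\alpha)=1$ for $\alpha\in\Delta_s$ and $\sigma^s(r_\alpha)=1$, $\sigma^l(r_\alpha)=-1$ for $\alpha\in\Delta_l$. For $t\in\{s,l\}$ put $$F^t=\{a\in F:\sigma^t\circ\psi(\mathrm{Stab}_{W^{\mathrm{aff}}}(a))=\{1\}\},\qquad F^{t\vee}=\{a\in F^\vee:\sigma^t\circ\widehat\psi(\mathrm{Stab}_{\widehat W^{\mathrm{aff}}}(a))=\{1\}\},$$ and, for an integer $M\ge 1$, let $F^t_M$ be the (finite) set of cosets in $\tfrac1M P^\vee/Q^\vee$ with a representative in $F^t$, and $\Lambda^t_M$ the set of cosets in $P/MQ$ with a representative in $MF^{t\vee}$. For $b\in P$ let $$\phi^t_b(a)=\sum_{w\in W}\sigma^t(w)\,e^{2\pi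 i\langle wb,a\rangle},$$ a function on $\mathbb{R}^n/Q^\vee$, whose restriction to $\frac1M P^\vee/Q^\vee$ depends only on the coset $\lambda=b+MQ$; this restriction is denoted by $\phi^t_\lambda$. Let $\varepsilon(x)$ be the size of the $W$-orbit of $x\in\mathbb{R}^n/Q^\vee$, let $h^\vee_\lambda$ be the order of the stabilizer in $W$ of $\lambda\in\mathbb{R}^n/MQ$, and put $$\langle f,g\rangle_{F^t_M}=\sum_{x\in F^t_M}\varepsilon(x)f(x)\overline{g(x)}.$$ Then for all $\lambda,\lambda'\in\Lambda^s_M$ $$\langle\phi^s_\lambda,\phi^s_{\lambda'}\rangle_{F^s_M}=c\,|W|\,M^n\,h^\vee_\lambda\,\delta_{\lambda,\lambda'},$$ and for all $\lambda,\lambda'\in\Lambda^l_M$ $$\langle\phi^l_\lambda,\phi^l_{\lambda'}\rangle_{F^l_M}=c\,|W|\,M^n\,h^\vee_\lambda\,\delta_{\lambda,\lambda'}.$$ -/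

import Mathlib

open scoped RealInnerProductSpace

noncomputable section

namespace OrbitFunctions

open RootPairing Module

variable {ι V : Type*} [NormedAddCommGroup V] [InnerProductSpace ℝ V]

/-- A root pairing of `V` with itself is *Euclidean* if the pairing is the scalar product of `V`
and the coroots are the vectors `α^∨ = 2 α / ⟪α, α⟫`.  So roots, coroots, weights and coweights
all live in the same Euclidean space. -/
class IsEuclidean (P : RootPairing ι ℝ V V) : Prop where
  toLinearMap_apply : ∀ x y : V, P.toLinearMap x y = ⟪x, y⟫
  coroot_eq : ∀ i, P.coroot i = (2 / ⟪P.root i, P.root i⟫) • P.root i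

/-! ### Lattices and the action of the Weyl group -/

/-- The root lattice `Q`. -/
def rootLattice (P : RootPairing ι ℝ V V) : AddSubgroup V := (P.rootSpan ℤ).toAddSubgroup

/-- The dual root lattice `Q^∨`, spanned by the coroots. -/
def corootLattice (P : RootPairing ι ℝ V V) : AddSubgroup V := (P.corootSpan ℤ).toAddSubgroup

/-- The `ℤ`-dual `{x | ⟪x, y⟫ ∈ ℤ for all y ∈ L}` of an additive subgroup `L` of `V`. -/
def dualLattice (L : AddSubgroup V) : AddSubgroup V where
  carrier := {x | ∀ y ∈ L, ∃ k : ℤ, ⟪x, y⟫ = k}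
  zero_mem' := fun y _ ↦ ⟨0, by simp⟩
  add_mem' := by
    intro x x' hx hx' y hy
    obtain ⟨k, hk⟩ := hx y hy
    obtain ⟨k', hk'⟩ := hx' y hy
    exact ⟨k + k', by rw [inner_add_left, hk, hk']; push_cast; rfl⟩
  neg_mem' := by
    intro x hx y hy
    obtain ⟨k, hk⟩ := hx y hy
    exact ⟨-k, by rw [inner_neg_left, hk]; push_cast; rfl⟩

/-- The weight lattice `P`, the `ℤ`-dual of `Q^∨`. -/
def weightLattice (P : RootPairing ι ℝ V V) : AddSubgroup V := dualLattice (corootLattice P)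

/-- The dual weight lattice `P^∨`, the `ℤ`-dual of `Q`. -/
def coweightLattice (P : RootPairing ι ℝ V V) : AddSubgroup V := dualLattice (rootLattice P)

/-- The lattice `M Q`. -/
def scaledRootLattice (P : RootPairing ι ℝ V V) (M : ℕ) : AddSubgroup V :=
  (rootLattice P).map (nsmulAddMonoidHom M)

/-- Subgroups of `V` that are stable under the Weyl group `W`. -/
class IsWeylStable (P : RootPairing ι ℝ V V) (L : AddSubgroup V) : Prop where
  smul_mem : ∀ (w : P.weylGroup) {x : V}, x ∈ L → w • x ∈ L

theorem inner_smul_smul (P : RootPairing ι ℝ V V) [IsEuclidean P] (w : P.weylGroup) (x y : V) :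
    ⟪w • x, w • y⟫ = ⟪x, y⟫ := by
  revert x y
  obtain ⟨g, hg⟩ := w
  induction hg using weylGroup.induction with
  | mem i =>
    intro x y
    have h0 : ⟪P.root i, P.root i⟫ ≠ 0 := inner_self_ne_zero.mpr (P.ne_zero i)
    have hr : ∀ z : V, (⟨Equiv.reflection P i, P.reflection_mem_weylGroup i⟩ : P.weylGroup) • z =
        z - (2 * ⟪z, P.root i⟫ / ⟪P.root i, P.root i⟫) • P.root i := by
      intro z
      change P.reflection i z = _
      rw [RootPairing.reflection_apply, coroot', LinearMap.flip_apply, IsEuclidean.toLinearMap_apply,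
        IsEuclidean.coroot_eq, inner_smul_right]
      congr 2
      ring
    rw [hr, hr]
    simp only [inner_sub_left, inner_sub_right, inner_smul_left, inner_smul_right,
      real_inner_comm (P.root i)]
    simp only [conj_trivial]
    field_simp
    ring
  | one => intro x y; rfl
  | mul g₁ g₂ hg₁ hg₂ h₁ h₂ =>
    intro x y
    rw [← Submonoid.mk_mul_mk _ _ _ hg₁ hg₂, mul_smul, mul_smul, h₁, h₂]

theorem smul_root (P : RootPairing ι ℝ V V) (w : P.weylGroup) (i : ι) :
    w • P.root i = P.root (P.weylGroupToPerm w i) :=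
  P.weylGroup_apply_root w i

theorem smul_real_smul (P : RootPairing ι ℝ V V) (w : P.weylGroup) (c : ℝ) (x : V) :
    w • c • x = c • w • x :=
  smul_comm (w : P.Aut) c x

theorem smul_coroot (P : RootPairing ι ℝ V V) [IsEuclidean P] (w : P.weylGroup) (i : ι) :
    w • P.coroot i = P.coroot (P.weylGroupToPerm w i) := by
  rw [IsEuclidean.coroot_eq, IsEuclidean.coroot_eq, smul_real_smul, ← smul_root,
    inner_smul_smul]

instance (P : RootPairing ι ℝ V V) : IsWeylStable P (rootLattice P) where
  smul_mem w x hx := by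
    change x ∈ Submodule.span ℤ _ at hx
    change w • x ∈ Submodule.span ℤ _
    induction hx using Submodule.span_induction with
    | mem x h =>
      obtain ⟨i, rfl⟩ := h
      exact Submodule.subset_span ⟨_, (smul_root P w i).symm⟩
    | zero => rw [smul_zero]; exact zero_mem _
    | add x y _ _ hx hy => rw [smul_add]; exact add_mem hx hy
    | smul a x _ hx => rw [smul_comm]; exact Submodule.smul_mem _ a hx

instance (P : RootPairing ι ℝ V V) [IsEuclidean P] : IsWeylStable P (corootLattice P) where
  smul_mem w x hx := by
    change x ∈ Submodule.span ℤ _ at hx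
    change w • x ∈ Submodule.span ℤ _
    induction hx using Submodule.span_induction with
    | mem x h =>
      obtain ⟨i, rfl⟩ := h
      exact Submodule.subset_span ⟨_, (smul_coroot P w i).symm⟩
    | zero => rw [smul_zero]; exact zero_mem _
    | add x y _ _ hx hy => rw [smul_add]; exact add_mem hx hy
    | smul a x _ hx => rw [smul_comm]; exact Submodule.smul_mem _ a hx

instance (P : RootPairing ι ℝ V V) (M : ℕ) : IsWeylStable P (scaledRootLattice P M) where
  smul_mem w x hx := by
    obtain ⟨y, hy, rfl⟩ := hx
    exact ⟨w • y, IsWeylStable.smul_mem w hy, (smul_comm w M y).symm⟩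

theorem smul_mem_weightLattice (P : RootPairing ι ℝ V V) [IsEuclidean P] (w : P.weylGroup)
    {x : V} (hx : x ∈ weightLattice P) : w • x ∈ weightLattice P := by
  intro y hy
  obtain ⟨k, hk⟩ := hx (w⁻¹ • y) (IsWeylStable.smul_mem w⁻¹ hy)
  exact ⟨k, by rw [← hk, ← inner_smul_smul P w x, smul_inv_smul]⟩

section Actions

variable (P : RootPairing ι ℝ V V) (L : AddSubgroup V) [IsWeylStable P L]

/-- The action of the Weyl group on a stable subgroup of `V`. -/
instance : DistribMulAction P.weylGroup L where
  smul w x := ⟨w • (x : V), IsWeylStable.smul_mem w x.2⟩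
  one_smul x := Subtype.ext (one_smul P.weylGroup (x : V))
  mul_smul w w' x := Subtype.ext (mul_smul w w' (x : V))
  smul_zero w := Subtype.ext (smul_zero w)
  smul_add w x y := Subtype.ext (smul_add w (x : V) (y : V))

/-- The action `w (x + L) = w x + L` of the Weyl group on the quotient `V / L`. -/
instance : MulAction P.weylGroup (V ⧸ L) where
  smul w := QuotientAddGroup.map L L (DistribSMul.toAddMonoidHom V w)
    fun _ hx ↦ IsWeylStable.smul_mem w hx
  one_smul x := by
    induction x using QuotientAddGroup.induction_on with
    | H x => exact congrArg _ (one_smul P.weylGroup x)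
  mul_smul w w' x := by
    induction x using QuotientAddGroup.induction_on with
    | H x => exact congrArg _ (mul_smul w w' x)

/-- The Weyl group acting on `L` by automorphisms, `L` written multiplicatively. -/
def weylToMulAut : P.weylGroup →* MulAut (Multiplicative L) where
  toFun w := AddEquiv.toMultiplicative (DistribMulAction.toAddEquiv L w)
  map_one' := MulEquiv.ext fun x ↦
    congrArg Multiplicative.ofAdd (one_smul P.weylGroup x.toAdd)
  map_mul' w w' := MulEquiv.ext fun x ↦
    congrArg Multiplicative.ofAdd (mul_smul w w' x.toAdd)

/-- The group `L ⋊ W`.  It is the affine Weyl group for `L = Q^∨` and the dual affine Weyl group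
for `L = Q`.  The retraction onto `W` is `SemidirectProduct.rightHom`. -/
abbrev AffineWeylGroup : Type _ := Multiplicative L ⋊[weylToMulAut P L] P.weylGroup

/-- The action of `L ⋊ W` on `V` by affine maps: `T(q) w` sends `a` to `w a + q`. -/
instance : MulAction (AffineWeylGroup P L) V where
  smul g a := g.right • a + (g.left.toAdd : V)
  one_smul a := by
    change (1 : P.weylGroup) • a + 0 = a
    rw [one_smul, add_zero]
  mul_smul g h a := by
    change (g.right * h.right) • a + ((g.left.toAdd : V) + g.right • (h.left.toAdd : V)) =
      g.right • (h.right • a + (h.left.toAdd : V)) + (g.left.toAdd : V)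
    rw [mul_smul, smul_add]
    abel

end Actions

/-! ### Sign homomorphisms -/

section Signs

variable (P : RootPairing ι ℝ V V)

/-- For every `W`-stable set `s` of roots there is exactly one homomorphism `W → {±1}` that takes
the value `-1` on the simple reflections `r_i` with `i ∈ s` and `1` on the other ones. -/
theorem existsUnique_signHom [Finite ι] [P.IsCrystallographic] [P.IsReduced] (b : P.Base)
    (s : Set ι) (hs : ∀ (w : P.weylGroup) (i : ι), P.weylGroupToPerm w i ∈ s ↔ i ∈ s) :
    ∃! σ : P.weylGroup →* ℤˣ, ∀ i, i ∈ b.support →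
      (i ∈ s → σ (weylGroup.ofIdx P i) = -1) ∧ (i ∉ s → σ (weylGroup.ofIdx P i) = 1) := by
  classical
  have := Fintype.ofFinite ι
  let _ := P.indexNeg
  have neg_perm : ∀ (w : P.weylGroup) (i : ι), P.weylGroupToPerm w (-i) =
      -P.weylGroupToPerm w i := by
    intro w i
    apply P.root.injective
    rw [← smul_root]
    simp only [root_reflectionPerm, indexNeg_neg, RootPairing.reflection_apply_self]
    rw [smul_neg, smul_root]
  have neg_s : ∀ i, -i ∈ s ↔ i ∈ s := fun i ↦ hs (weylGroup.ofIdx P i) i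
  have neg_pos : ∀ i, b.IsPos (-i) ↔ ¬ b.IsPos i := fun i ↦ Base.IsPos.neg_iff_not b i
  let e : ι → ℤˣ := fun i ↦ if b.IsPos i then 1 else -1
  have e_neg : ∀ i, e (-i) = -e i := by
    intro i
    by_cases h : b.IsPos i <;> simp only [e, neg_pos, h, not_true, not_false_iff, if_true,
      if_false, neg_neg]
  let S : Finset ι := Finset.univ.filter fun i ↦ i ∈ s ∧ b.IsPos i
  have hS : ∀ i, i ∈ S ↔ i ∈ s ∧ b.IsPos i := fun i ↦ by simp [S]
  let a : ι → ι := fun i ↦ if b.IsPos i then i else -i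
  have a_cases : ∀ i, a i = i ∨ a i = -i := by
    intro i
    by_cases h : b.IsPos i <;> simp [a, h]
  have a_pos : ∀ i, b.IsPos (a i) := by
    intro i
    by_cases h : b.IsPos i
    · simp only [a, h, if_true]
    · simp only [a, h, if_false]; exact (neg_pos i).mpr h
  have a_of_pos : ∀ i, b.IsPos i → a i = i := fun i h ↦ by simp only [a, h, if_true]
  have a_neg : ∀ i, a (-i) = a i := by
    intro i
    by_cases h : b.IsPos i <;> simp only [a, neg_pos, h, not_true, not_false_iff, if_true,
      if_false, neg_neg]
  have a_s : ∀ i, a i ∈ s ↔ i ∈ s := by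
    intro i
    rcases a_cases i with h | h <;> rw [h]
    exact neg_s i
  have a_perm_a : ∀ (w : P.weylGroup) i, a (P.weylGroupToPerm w (a i)) =
      a (P.weylGroupToPerm w i) := by
    intro w i
    rcases a_cases i with h | h <;> rw [h]
    rw [neg_perm, a_neg]
  let f : P.weylGroup → ℤˣ := fun w ↦ ∏ i ∈ S, e (P.weylGroupToPerm w i)
  have f_mul : ∀ w w', f (w * w') = f w * f w' := by
    intro w w'
    let t : ι → ℤˣ := fun i ↦ e (P.weylGroupToPerm w i) * e i
    have t_neg : ∀ i, t (-i) = t i := by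
      intro i
      simp only [t, neg_perm, e_neg, neg_mul_neg]
    have t_a : ∀ i, t (a i) = t i := by
      intro i
      rcases a_cases i with h | h <;> rw [h]
      exact t_neg i
    have h1 : f (w * w') = (∏ i ∈ S, t (P.weylGroupToPerm w' i)) * f w' := by
      rw [← Finset.prod_mul_distrib]
      refine Finset.prod_congr rfl fun i _ ↦ ?_
      simp only [t, mul_assoc, Int.units_mul_self, mul_one, map_mul, Equiv.Perm.mul_apply]
    have h2 : (∏ i ∈ S, t (P.weylGroupToPerm w' i)) = ∏ i ∈ S, t i := by
      refine Finset.prod_bij' (fun i _ ↦ a (P.weylGroupToPerm w' i))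
        (fun i _ ↦ a (P.weylGroupToPerm w'⁻¹ i)) ?_ ?_ ?_ ?_ ?_
      · intro i hi
        exact (hS _).mpr ⟨(a_s _).mpr ((hs _ _).mpr ((hS i).mp hi).1), a_pos _⟩
      · intro i hi
        exact (hS _).mpr ⟨(a_s _).mpr ((hs _ _).mpr ((hS i).mp hi).1), a_pos _⟩
      · intro i hi
        rw [a_perm_a, ← Equiv.Perm.mul_apply, ← map_mul, inv_mul_cancel, map_one]
        exact a_of_pos _ ((hS i).mp hi).2
      · intro i hi
        rw [a_perm_a, ← Equiv.Perm.mul_apply, ← map_mul, mul_inv_cancel, map_one]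
        exact a_of_pos _ ((hS i).mp hi).2
      · intro i _
        exact (t_a _).symm
    have h3 : (∏ i ∈ S, t i) = f w := by
      refine Finset.prod_congr rfl fun i hi ↦ ?_
      have : e i = 1 := if_pos ((hS i).mp hi).2
      simp only [t, this, mul_one]
    rw [h1, h2, h3]
  have perm_ofIdx : ∀ i j, P.weylGroupToPerm (weylGroup.ofIdx P i) j = P.reflectionPerm i j :=
    fun _ _ ↦ rfl
  have key : ∀ σ σ' : P.weylGroup →* ℤˣ,
      (∀ i ∈ b.support, σ (weylGroup.ofIdx P i) = σ' (weylGroup.ofIdx P i)) → σ = σ' := by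
    intro σ σ' h
    have conj : ∀ i j, weylGroup.ofIdx P (P.reflectionPerm j i) =
        weylGroup.ofIdx P j * weylGroup.ofIdx P i * weylGroup.ofIdx P j := by
      intro i j
      apply Subtype.ext
      apply Equiv.weightHom_injective P
      ext x
      change P.reflection (P.reflectionPerm j i) x =
        P.reflection j (P.reflection i (P.reflection j x))
      rw [reflection_reflectionPerm]
      rfl
    have all : ∀ i, σ (weylGroup.ofIdx P i) = σ' (weylGroup.ofIdx P i) := by
      intro i
      refine b.induction_reflect i ?_ h ?_
      · intro i hi
        rw [conj]; simp only [map_mul, hi]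
      · intro i j hi hj
        rw [conj]; simp only [map_mul, hi, h j hj]
    ext ⟨g, hg⟩ : 1
    induction hg using weylGroup.induction with
    | mem i => exact all i
    | one => exact (map_one σ).trans (map_one σ').symm
    | mul x y hx hy h1 h2 =>
      rw [← Submonoid.mk_mul_mk _ _ _ hx hy]
      exact (map_mul σ _ _).trans ((congrArg₂ _ h1 h2).trans (map_mul σ' _ _).symm)
  have f_val : ∀ i, i ∈ b.support →
      (i ∈ s → f (weylGroup.ofIdx P i) = -1) ∧ (i ∉ s → f (weylGroup.ofIdx P i) = 1) := by
    intro i hi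
    have hip : b.IsPos i := Base.isPos_of_mem_support hi
    have hval : ∀ j, b.IsPos j → j ≠ i → e (P.reflectionPerm i j) = 1 :=
      fun j hj hne ↦ if_pos (hj.reflectionPerm hi hne)
    constructor
    · intro his
      change ∏ j ∈ S, e (P.reflectionPerm i j) = -1
      rw [Finset.prod_eq_single i]
      · change e (-i) = -1
        rw [e_neg]
        exact congrArg _ (if_pos hip)
      · intro j hj hne
        exact hval j ((hS j).mp hj).2 hne
      · intro h
        exact absurd ((hS i).mpr ⟨his, hip⟩) h
    · intro his
      change ∏ j ∈ S, e (P.reflectionPerm i j) = 1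
      refine Finset.prod_eq_one fun j hj ↦ hval j ((hS j).mp hj).2 ?_
      rintro rfl
      exact his ((hS j).mp hj).1
  refine ⟨MonoidHom.mk' f f_mul, f_val, fun τ hτ ↦ key _ _ fun i hi ↦ ?_⟩
  by_cases his : i ∈ s
  · exact ((hτ i hi).1 his).trans ((f_val i hi).1 his).symm
  · exact ((hτ i hi).2 his).trans ((f_val i hi).2 his).symm

/-- The homomorphism `W → {±1}` with value `-1` on the simple reflections `r_i`, `i ∈ s`, and with
value `1` on the other simple reflections. -/
def signHom [Finite ι] [P.IsCrystallographic] [P.IsReduced] (b : P.Base)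
    (s : Set ι) (hs : ∀ (w : P.weylGroup) (i : ι), P.weylGroupToPerm w i ∈ s ↔ i ∈ s) :
    P.weylGroup →* ℤˣ :=
  (existsUnique_signHom P b s hs).choose

theorem signHom_simple [Finite ι] [P.IsCrystallographic] [P.IsReduced] (b : P.Base)
    (s : Set ι) (hs : ∀ (w : P.weylGroup) (i : ι), P.weylGroupToPerm w i ∈ s ↔ i ∈ s) :
    ∀ i, i ∈ b.support →
      (i ∈ s → signHom P b s hs (weylGroup.ofIdx P i) = -1) ∧
      (i ∉ s → signHom P b s hs (weylGroup.ofIdx P i) = 1) :=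
  (existsUnique_signHom P b s hs).choose_spec.1

/-- The short roots of a root system with two different lengths of roots. -/
def shortRoots : Set ι := {i | ∃ j, ‖P.root i‖ < ‖P.root j‖}

/-- The long roots of a root system with two different lengths of roots. -/
def longRoots : Set ι := {i | ∃ j, ‖P.root j‖ < ‖P.root i‖}

theorem norm_root_perm [IsEuclidean P] (w : P.weylGroup) (i : ι) :
    ‖P.root (P.weylGroupToPerm w i)‖ = ‖P.root i‖ := by
  rw [← smul_root, @norm_eq_sqrt_real_inner _ _ _ (w • P.root i),
    @norm_eq_sqrt_real_inner _ _ _ (P.root i), inner_smul_smul]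

variable [Finite ι] [P.IsCrystallographic] [P.IsReduced] [IsEuclidean P] (b : P.Base)

/-- The sign homomorphism `σ^s`: `-1` on short and `1` on long simple reflections. -/
def shortSign : P.weylGroup →* ℤˣ :=
  signHom P b (shortRoots P) fun w i ↦ by
    simp only [shortRoots, Set.mem_ofPred_eq, norm_root_perm]

/-- The sign homomorphism `σ^l`: `-1` on long and `1` on short simple reflections. -/
def longSign : P.weylGroup →* ℤˣ :=
  signHom P b (longRoots P) fun w i ↦ by
    simp only [longRoots, Set.mem_ofPred_eq, norm_root_perm]

end Signs

/-! ### Fundamental domains -/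

section Domains

theorem exists_forall_height_le [Finite ι] [Nonempty ι] {P : RootPairing ι ℝ V V} (b : P.Base) :
    ∃ i, ∀ j, b.height j ≤ b.height i :=
  Finite.exists_max b.height

/-- (The index of) the highest root, i.e. the root of largest height.  Applied to `b.flip` it gives
the index of the highest dual root. -/
def highestRoot [Finite ι] [Nonempty ι] {P : RootPairing ι ℝ V V} (b : P.Base) : ι :=
  (exists_forall_height_le b).choose

variable [Finite ι] [Nonempty ι] (P : RootPairing ι ℝ V V) (b : P.Base)

/-- The fundamental domain `F` of the affine Weyl group: the points `∑ y_i ω_i^∨` with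
`y_i = ⟪α_i, a⟫ ≥ 0` and `1 - ∑ m_i y_i = 1 - ⟪ξ, a⟫ ≥ 0`, where `ξ = ∑ m_i α_i` is the highest
root. -/
def fundamentalDomain : Set V :=
  {a | (∀ i ∈ b.support, 0 ≤ ⟪P.root i, a⟫) ∧ ⟪P.root (highestRoot b), a⟫ ≤ 1}

/-- The dual fundamental domain `F^∨`: the points `∑ z_i ω_i` with `z_i = ⟪α_i^∨, a⟫ ≥ 0` and
`1 - ∑ m_i^∨ z_i = 1 - ⟪η, a⟫ ≥ 0`, where `η = ∑ m_i^∨ α_i^∨` is the highest dual root. -/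
def dualFundamentalDomain : Set V :=
  {a | (∀ i ∈ b.support, 0 ≤ ⟪P.coroot i, a⟫) ∧ ⟪P.coroot (highestRoot b.flip), a⟫ ≤ 1}

variable [IsEuclidean P] (σ : P.weylGroup →* ℤˣ)

/-- The points `a` of `F` with `σ ∘ ψ (Stab a) = {1}`, where `Stab a` is the stabilizer in the
affine Weyl group `Q^∨ ⋊ W` and `ψ` the retraction onto `W`.  This is `F^s` for `σ = σ^s` and `F^l`
for `σ = σ^l`. -/
def signedDomain : Set V :=
  {a ∈ fundamentalDomain P b |
    (MulAction.stabilizer (AffineWeylGroup P (corootLattice P)) a).map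
      (σ.comp SemidirectProduct.rightHom) = ⊥}

/-- The points `a` of `F^∨` with `σ ∘ ψ (Stab a) = {1}`, where `Stab a` is the stabilizer in the
dual affine Weyl group `Q ⋊ W` and `ψ` the retraction onto `W`.  This is `F^{s∨}` for `σ = σ^s` and
`F^{l∨}` for `σ = σ^l`. -/
def dualSignedDomain : Set V :=
  {a ∈ dualFundamentalDomain P b |
    (MulAction.stabilizer (AffineWeylGroup P (rootLattice P)) a).map
      (σ.comp SemidirectProduct.rightHom) = ⊥}

/-! ### Grids, orbit functions, scalar product -/

/-- The grid of the cosets in `(1/M) P^∨ / Q^∨` that have a representative in the domain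
`F^s` (for `σ = σ^s`) or `F^l` (for `σ = σ^l`). -/
def pointGrid (M : ℕ) : Set (V ⧸ corootLattice P) :=
  {x | ∃ a ∈ signedDomain P b σ, M • a ∈ coweightLattice P ∧ (a : V ⧸ corootLattice P) = x}

/-- The set of the cosets in `P / M Q` that have a representative in `M F^{s∨}` (for `σ = σ^s`)
or `M F^{l∨}` (for `σ = σ^l`). -/
def weightGrid (M : ℕ) : Set (V ⧸ scaledRootLattice P M) :=
  {l | ∃ a ∈ dualSignedDomain P b σ, M • a ∈ weightLattice P ∧
    ((M • a : V) : V ⧸ scaledRootLattice P M) = l}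

end Domains

section OrbitFunctions

variable (P : RootPairing ι ℝ V V) (σ : P.weylGroup →* ℤˣ)

instance [Finite ι] [P.IsRootSystem] : Finite P.weylGroup := by
  refine Finite.of_injective (fun w ↦ P.weylGroupToPerm w) fun w w' h ↦ ?_
  apply Subtype.ext
  apply Equiv.weightHom_injective P
  refine LinearEquiv.toLinearMap_injective
    (LinearMap.ext_on_range (v := P.root) IsRootSystem.span_root_eq_top fun i ↦ ?_)
  exact (smul_root P w i).trans ((congrArg (fun f : Equiv.Perm ι ↦ P.root (f i)) h).trans
    (smul_root P w' i).symm)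

/-- The function `φ_b(a) = ∑_{w ∈ W} σ(w) exp(2 π i ⟪w b, a⟫)` on `V`. -/
def orbitFun (b a : V) : ℂ :=
  ∑ᶠ w : P.weylGroup, ((σ w : ℤ) : ℂ) * Complex.exp (2 * Real.pi * Complex.I * (⟪w • b, a⟫ : ℝ))

variable [IsEuclidean P]

theorem orbitFun_add {b : V} (hb : b ∈ weightLattice P) (a : V) {q : V}
    (hq : q ∈ corootLattice P) : orbitFun P σ b (a + q) = orbitFun P σ b a := by
  refine finsum_congr fun w ↦ ?_
  obtain ⟨k, hk⟩ := smul_mem_weightLattice P w hb q hq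
  congr 1
  rw [inner_add_right, hk, Complex.exp_eq_exp_iff_exists_int]
  exact ⟨k, by push_cast; ring⟩

/-- The function `φ_b`, for a weight `b`, on the torus `V / Q^∨`. -/
def torusOrbitFun (b : weightLattice P) : V ⧸ corootLattice P → ℂ :=
  Quotient.lift (orbitFun P σ (b : V)) fun a a' h ↦ by
    have h' : -a + a' ∈ corootLattice P := QuotientAddGroup.leftRel_apply.mp h
    rw [← orbitFun_add P σ b.2 a h', add_neg_cancel_left]

/-- The order `ε(x)` of the `W`-orbit of a point `x` of the torus `V / Q^∨`. -/
def orbitSize (x : V ⧸ corootLattice P) : ℕ := Nat.card (MulAction.orbit P.weylGroup x)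

/-- The scalar product `∑_{x ∈ X} ε(x) f(x) conj(g(x))`, for finite sets `X` of points of the
torus `V / Q^∨`. -/
def gridInner (X : Set (V ⧸ corootLattice P)) (f g : V ⧸ corootLattice P → ℂ) : ℂ :=
  ∑ᶠ x ∈ X, (orbitSize P x : ℂ) * f x * (starRingEnd ℂ) (g x)

end OrbitFunctions

/-- The order `h^∨_λ` of the stabilizer in `W` of an element `λ` of `V / M Q`. -/
def dualStabSize (P : RootPairing ι ℝ V V) {M : ℕ} (l : V ⧸ scaledRootLattice P M) : ℕ :=
  Nat.card (MulAction.stabilizer P.weylGroup l)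

end OrbitFunctions

end

set_option linter.unusedSectionVars false

noncomputable section

namespace OrbitFunctions

open RootPairing Module

variable {ι V : Type*} [NormedAddCommGroup V] [InnerProductSpace ℝ V]

/-! ### Roots and coroots in a Euclidean space -/

section Euclidean

variable (P : RootPairing ι ℝ V V) [IsEuclidean P]

/-! Let `G = (1/M) P^∨ / Q^∨`, a finite group on which each `φ_λ` is a signed sum of characters. The
relation `φ_λ(w x) = σ(w) φ_λ(x)` (`torusOrbitFun_smul`) makes `φ_λ conj(φ_λ')` invariant under `W`,
and makes it vanish at points fixed by an element of sign `-1`. Every point of `V` is conjugate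
under the affine Weyl group to exactly one point of `F` (`exists_mem_fundamentalDomain`,
`eq_of_mem_fundamentalDomain`). Hence the orbit-weighted sum over the grid is a plain sum over `G`
(`gridInner_eq_finsum_torusGrid`).

The character of a weight `μ` sums over `G` to `|G| = c M^n` if `μ ∈ MQ` and to `0` otherwise
(`sum_weightChar`, `card_torusGrid`). Expanding the product and indexing the pairs of Weyl group
elements as `(w u, w)`, only the `u` with `u λ = λ'` in `V / MQ` survive. As `λ` and `λ'` have
representatives in `M F^∨`, this forces `λ = λ'` and, by the stabilizer condition, `σ(u) = 1`
(`eq_and_sign_eq_one_of_mem_weightGrid`). So each of the `|W|` elements `w` contributes `|G|` once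
per element of the stabilizer of `λ`. Only the multiplicativity of `σ` enters.

The geometric core is that `F` is a strict fundamental domain. Existence: the orbit point nearest to
an inner point `z` of `F` lies in `F`. Uniqueness: the affine Weyl group is generated by the wall
reflections (`isWallWord_affine`), and a word that maps a point of `F` into `F` can be shortened
without changing the image of that point (`foldr_eq_self_of_chamber`). The affine wall is controlled
through the maximal height of `ξ` (`pairingIn_highestRoot`, `inner_root_le_highestRoot`). The domain
`F^∨` is treated as the `F` of the dual root system. -/

theorem inner_root_self_pos (i : ι) : 0 < ⟪P.root i, P.root i⟫ :=
  real_inner_self_pos.mpr (P.ne_zero i)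

/-- Allows the results on `F` and `Q^∨ ⋊ W` to be applied to the dual system, and so to `F^∨` and `Q
⋊ W`. -/
instance isEuclidean_flip : IsEuclidean P.flip where
  toLinearMap_apply x y := by
    rw [← real_inner_comm, ← IsEuclidean.toLinearMap_apply (P := P)]
    rfl
  coroot_eq i := by
    have h0 := (inner_root_self_pos P i).ne'
    change P.root i = (2 / ⟪P.coroot i, P.coroot i⟫) • P.coroot i
    rw [IsEuclidean.coroot_eq, inner_smul_left, inner_smul_right, smul_smul]
    simp only [conj_trivial]
    field_simp
    simp

theorem inner_root_coroot [P.IsCrystallographic] (i j : ι) :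
    ⟪P.root i, P.coroot j⟫ = (P.pairingIn ℤ i j : ℝ) := by
  rw [← IsEuclidean.toLinearMap_apply (P := P), root_coroot_eq_pairing,
    ← P.algebraMap_pairingIn ℤ i j]
  rfl

theorem inner_root_coroot_self (i : ι) : ⟪P.root i, P.coroot i⟫ = 2 := by
  rw [← IsEuclidean.toLinearMap_apply (P := P), root_coroot_two]

theorem inner_root_eq (i : ι) (x : V) :
    ⟪P.root i, x⟫ = ⟪P.root i, P.root i⟫ / 2 * ⟪P.coroot i, x⟫ := by
  have h0 := (inner_root_self_pos P i).ne'
  rw [IsEuclidean.coroot_eq, inner_smul_left]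
  simp only [conj_trivial]
  field_simp

theorem ofIdx_smul_eq (i : ι) (x : V) :
    weylGroup.ofIdx P i • x = x - ⟪P.root i, x⟫ • P.coroot i := by
  change P.reflection i x = _
  rw [RootPairing.reflection_apply, coroot', LinearMap.flip_apply, IsEuclidean.toLinearMap_apply,
    IsEuclidean.coroot_eq, inner_smul_right, smul_smul, real_inner_comm (P.root i) x]
  congr 2
  ring

theorem inner_root_smul (w : P.weylGroup) (i : ι) (x : V) :
    ⟪P.root i, w • x⟫ = ⟪P.root (P.weylGroupToPerm w⁻¹ i), x⟫ := by
  rw [← smul_root, ← inner_smul_smul P w (w⁻¹ • P.root i), smul_inv_smul]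

theorem exists_inner_root_eq_int [P.IsCrystallographic] {q : V} (hq : q ∈ corootLattice P) (i : ι) :
    ∃ k : ℤ, ⟪P.root i, q⟫ = k := by
  change q ∈ Submodule.span ℤ _ at hq
  induction hq using Submodule.span_induction with
  | mem x h =>
    obtain ⟨j, rfl⟩ := h
    exact ⟨_, inner_root_coroot P i j⟩
  | zero => exact ⟨0, by simp⟩
  | add x y _ _ hx hy =>
    obtain ⟨k, hk⟩ := hx
    obtain ⟨l, hl⟩ := hy
    exact ⟨k + l, by rw [inner_add_right, hk, hl]; push_cast; rfl⟩
  | smul a x _ hx =>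
    obtain ⟨k, hk⟩ := hx
    exact ⟨a * k, by rw [← Int.cast_smul_eq_zsmul ℝ, inner_smul_right, hk]; push_cast; rfl⟩

theorem coroot_mem_corootLattice (i : ι) : P.coroot i ∈ corootLattice P :=
  Submodule.subset_span ⟨i, rfl⟩

end Euclidean

theorem exists_dual_basis {κ : Type*} [Finite κ] [DecidableEq κ] (v : Basis κ ℝ V) :
    ∃ e : Basis κ ℝ V, ∀ i j, ⟪e i, v j⟫ = if j = i then 1 else 0 := by
  have : FiniteDimensional ℝ V := v.finiteDimensional_of_finite
  have hB : LinearMap.BilinForm.Nondegenerate (innerₗ V : LinearMap.BilinForm ℝ V) :=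
    ⟨fun x hx ↦ inner_self_eq_zero.mp (hx x), fun x hx ↦ inner_self_eq_zero.mp (hx x)⟩
  exact ⟨LinearMap.BilinForm.dualBasis _ hB v, fun i j ↦
    LinearMap.BilinForm.apply_dualBasis_left hB v i j⟩

/-! ### The highest root -/

section Highest

variable {P : RootPairing ι ℝ V V} (b : P.Base)

theorem height_le_highestRoot [Finite ι] [Nonempty ι] (i : ι) :
    b.height i ≤ b.height (highestRoot b) :=
  (exists_forall_height_le b).choose_spec i

variable [P.IsCrystallographic] [Finite ι]

theorem isPos_highestRoot [Nonempty ι] : b.IsPos (highestRoot b) := by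
  obtain ⟨i, hi⟩ := b.support_nonempty
  exact lt_of_lt_of_le (Base.isPos_of_mem_support hi) (height_le_highestRoot b i)

theorem isPos_reflectionPerm_self (i : ι) : b.IsPos (P.reflectionPerm i i) ↔ ¬ b.IsPos i :=
  Base.IsPos.neg_iff_not b i

variable {b} in
theorem inner_root_nonneg {i : ι} (hi : b.IsPos i) {a : V}
    (ha : ∀ j ∈ b.support, 0 ≤ ⟪P.root j, a⟫) : 0 ≤ ⟪P.root i, a⟫ := by
  refine hi.induction_on_add ha fun i j k hk h hj ↦ ?_
  rw [hk, inner_add_left]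
  exact add_nonneg h (ha j hj)

variable {b} in
-- Both sides are additive. With `ε > 0` this produces an inner point of `F`; with `ε = 0` it shows
-- that a vector orthogonal to the simple roots is orthogonal to every root.
theorem inner_root_eq_height_mul {a : V} {ε : ℝ} (ha : ∀ j ∈ b.support, ⟪P.root j, a⟫ = ε) (i : ι) :
    ⟪P.root i, a⟫ = b.height i * ε := by
  refine b.induction_add i (p := fun i ↦ ⟪P.root i, a⟫ = b.height i * ε) ?_ ?_ ?_
  · intro i hi
    have h := b.height_reflectionPerm_self i
    simp only [indexNeg_neg] at h
    rw [h, root_reflectionPerm, RootPairing.reflection_apply_self, inner_neg_left, hi]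
    push_cast
    ring
  · intro i hi
    rw [ha i hi, Base.height_one_of_mem_support hi, Int.cast_one, one_mul]
  · intro i j k hk hi hj
    rw [hk, inner_add_left, hi, ha j hj, b.height_add hk, Base.height_one_of_mem_support hj]
    push_cast
    ring

variable [IsEuclidean P]

theorem inner_root_root_sign (i j : ι) :
    ⟪P.root i, P.root j⟫ = ⟪P.root j, P.root j⟫ / 2 * (P.pairingIn ℤ i j : ℝ) := by
  rw [real_inner_comm, inner_root_eq, ← inner_root_coroot, real_inner_comm (P.coroot j)]

theorem pairingIn_nonneg_iff {i j : ι} :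
    0 ≤ P.pairingIn ℤ i j ↔ 0 ≤ ⟪P.root j, P.root i⟫ := by
  rw [real_inner_comm, inner_root_root_sign,
    mul_nonneg_iff_of_pos_left (half_pos (inner_root_self_pos P j)), Int.cast_nonneg_iff]

/-- A negative pairing would make `ξ + β` a root of larger height than `ξ`. -/
theorem inner_highestRoot_nonneg [Nonempty ι] {j : ι} (hj : b.IsPos j) :
    0 ≤ P.pairingIn ℤ j (highestRoot b) := by
  by_contra! h
  by_cases hne : P.root j = -P.root (highestRoot b)
  · have h1 : j = P.reflectionPerm (highestRoot b) (highestRoot b) := by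
      apply P.root.injective
      rw [hne]; simp
    rw [h1, isPos_reflectionPerm_self] at hj
    exact hj (isPos_highestRoot b)
  · obtain ⟨k, hk⟩ := P.root_add_root_mem_of_pairingIn_neg h hne
    have h1 := b.height_add hk
    have h2 := height_le_highestRoot b k
    rw [b.isPos_iff] at hj
    omega

/-- The pairing of a positive root `β ≠ ξ` with the highest root `ξ` is `0` or `1`, and in the
second case `ξ - β` is a positive root. -/
theorem pairingIn_highestRoot [Nonempty ι] {j : ι} (hj : b.IsPos j) (hne : j ≠ highestRoot b) :
    P.pairingIn ℤ j (highestRoot b) = 0 ∨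
      P.pairingIn ℤ j (highestRoot b) = 1 ∧
        ∃ k, b.IsPos k ∧ P.root k = P.root (highestRoot b) - P.root j := by
  rcases (inner_highestRoot_nonneg b hj).eq_or_lt with h | h
  · exact Or.inl h.symm
  right
  have hle := height_le_highestRoot b j
  have hξ := isPos_highestRoot b
  rw [b.isPos_iff] at hξ hj
  -- `β - ξ` is a root, so its height is not `0`; this makes `ht β < ht ξ` strict.
  obtain ⟨k, hk⟩ := P.root_sub_root_mem_of_pairingIn_pos h hne
  have hk0 := b.height_ne_zero k
  have hk1 := b.height_sub hk
  have hr : P.root (P.reflectionPerm k k) = P.root (highestRoot b) - P.root j := by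
    rw [root_reflectionPerm, RootPairing.reflection_apply_self, hk, neg_sub]
  refine ⟨?_, P.reflectionPerm k k, ?_, hr⟩
  -- For the pairing `m`, the root `-r_ξ β = m ξ - β` has height `m ht ξ - ht β`, which would exceed
  -- `ht ξ` if `m ≥ 2`.
  · have h2 : P.root (P.reflectionPerm (highestRoot b) j) =
        P.root j + (-P.pairingIn ℤ j (highestRoot b)) • P.root (highestRoot b) := by
      rw [root_reflectionPerm, neg_smul, reflection_apply_root' ℤ, sub_eq_add_neg]
    have h3 := b.height_add_zsmul h2
    have h4 := height_le_highestRoot b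
      (P.reflectionPerm (P.reflectionPerm (highestRoot b) j) (P.reflectionPerm (highestRoot b) j))
    have h5 := b.height_reflectionPerm_self (P.reflectionPerm (highestRoot b) j)
    simp only [indexNeg_neg] at h5
    rw [h5, h3, smul_eq_mul] at h4
    by_contra hne1
    have h6 : 2 ≤ P.pairingIn ℤ j (highestRoot b) := by omega
    nlinarith [mul_le_mul_of_nonneg_right h6 hξ.le, lt_of_le_of_ne hle (by omega)]
  · rw [b.isPos_iff, b.height_sub hr]
    omega

variable [P.IsReduced] [P.IsIrreducible]

/-- A dominant root has positive scalar product with every dominant root. -/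
theorem inner_pos_of_dominant {i j : ι} (hi : ∀ k ∈ b.support, 0 ≤ ⟪P.root k, P.root i⟫)
    (hj : ∀ k ∈ b.support, 0 ≤ ⟪P.root k, P.root j⟫) : 0 < ⟪P.root i, P.root j⟫ := by
  have pos : ∀ i, (∀ k ∈ b.support, 0 ≤ ⟪P.root k, P.root i⟫) → b.IsPos i := by
    intro i hi
    by_contra h
    have := inner_root_nonneg ((isPos_reflectionPerm_self b i).mpr h) hi
    rw [root_reflectionPerm, RootPairing.reflection_apply_self, inner_neg_left] at this
    linarith [inner_root_self_pos P i]
  obtain ⟨f, hf₀, hf₁, hf₂⟩ := b.exists_root_eq_sum_int i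
  have hf : 0 < f := by
    refine hf₁.resolve_right fun h ↦ ?_
    have h1 := (b.isPos_iff).mp (pos i hi)
    rw [Base.height_eq_sum hf₂] at h1
    exact h1.not_ge (Finset.sum_nonpos fun k _ ↦ h.le k)
  have expand : ∀ x : V, ⟪P.root i, x⟫ = ∑ k ∈ b.support, (f k : ℝ) * ⟪P.root k, x⟫ := by
    intro x
    rw [hf₂, sum_inner]
    refine Finset.sum_congr rfl fun k _ ↦ ?_
    rw [← Int.cast_smul_eq_zsmul ℝ, inner_smul_left]
    simp
  have hfn : ∀ k, (0 : ℝ) ≤ f k := fun k ↦ by exact_mod_cast hf.le k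
  -- Dominance makes a simple root with coefficient `0` orthogonal to all those with nonzero
  -- coefficient. The latter therefore span a subspace stable under the simple reflections, which is
  -- all of `V` by irreducibility, and a simple root with coefficient `0` would be orthogonal to
  -- `V`.
  have hsupp : ∀ k ∈ b.support, f k ≠ 0 := by
    let q : Submodule ℝ V := Submodule.span ℝ (P.root '' {k | k ∈ b.support ∧ f k ≠ 0})
    have orth : ∀ k ∈ b.support, f k = 0 → ∀ l ∈ b.support, f l ≠ 0 →
        ⟪P.root l, P.root k⟫ = 0 := by
      intro k hk hk0 l hl hl0
      have hle : ∀ m ∈ b.support, (f m : ℝ) * ⟪P.root m, P.root k⟫ ≤ 0 := by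
        intro m hm
        by_cases hmk : m = k
        · rw [hmk, hk0]; simp
        · refine mul_nonpos_of_nonneg_of_nonpos (hfn m) ?_
          have h1 := b.pairingIn_le_zero_of_ne hmk hm hk
          rw [inner_root_root_sign]
          exact mul_nonpos_of_nonneg_of_nonpos (half_pos (inner_root_self_pos P k)).le
            (by exact_mod_cast h1)
      have hsum := (Finset.sum_eq_zero_iff_of_nonpos hle).mp
        (le_antisymm (Finset.sum_nonpos hle) (by
          rw [← expand, real_inner_comm]; exact hi k hk)) l hl
      exact (mul_eq_zero.mp hsum).resolve_left (by exact_mod_cast hl0)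
    have hq : q = ⊤ := by
      refine IsIrreducible.eq_top_of_invtSubmodule_reflection (P := P) _
        ((b.forall_mem_support_invtSubmodule_iff q).mp fun k hk ↦ ?_) ?_
      · by_cases hk0 : f k = 0
        · rw [Module.End.mem_invtSubmodule]
          refine Submodule.span_le.mpr ?_
          rintro _ ⟨l, ⟨hl, hl0⟩, rfl⟩
          have : P.reflection k (P.root l) = P.root l := by
            have h1 : weylGroup.ofIdx P k • P.root l = P.root l := by
              rw [ofIdx_smul_eq, real_inner_comm, orth k hk hk0 l hl hl0, zero_smul, sub_zero]
            exact h1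
          change P.reflection k (P.root l) ∈ q
          rw [this]
          exact Submodule.subset_span ⟨l, ⟨hl, hl0⟩, rfl⟩
        · exact Submodule.mem_invtSubmodule_reflection_of_mem _ _
            (Submodule.subset_span ⟨k, ⟨hk, hk0⟩, rfl⟩)
      · intro h0
        obtain ⟨k, hk⟩ : ∃ k ∈ b.support, f k ≠ 0 := by
          by_contra! h
          exact P.ne_zero i (by rw [hf₂]; exact Finset.sum_eq_zero fun k hk ↦ by rw [h k hk, zero_smul])
        have : P.root k ∈ q := Submodule.subset_span ⟨k, hk, rfl⟩
        rw [h0, Submodule.mem_bot] at this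
        exact P.ne_zero k this
    intro k hk hk0
    have hmem : P.root k ∈ q := hq ▸ Submodule.mem_top
    have hle : q ≤ LinearMap.ker (innerₗ V (P.root k)) := by
      refine Submodule.span_le.mpr ?_
      rintro _ ⟨l, ⟨hl, hl0⟩, rfl⟩
      rw [SetLike.mem_coe, LinearMap.mem_ker, innerₗ_apply_apply, real_inner_comm]
      exact orth k hk hk0 l hl hl0
    exact (inner_root_self_pos P k).ne' (hle hmem)
  have hterm : ∀ k ∈ b.support, 0 ≤ (f k : ℝ) * ⟪P.root k, P.root j⟫ :=
    fun k hk ↦ mul_nonneg (hfn k) (hj k hk)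
  rw [expand]
  -- If the sum vanishes, so does each term; all coefficients being positive, `α_j` is orthogonal to
  -- every simple root and hence to itself.
  refine lt_of_le_of_ne (Finset.sum_nonneg hterm) fun h0 ↦ ?_
  have hz := (Finset.sum_eq_zero_iff_of_nonneg hterm).mp h0.symm
  have := inner_root_eq_height_mul (b := b) (a := P.root j) (ε := 0) (fun k hk ↦
    (mul_eq_zero.mp (hz k hk)).resolve_left (by exact_mod_cast hsupp k hk)) j
  rw [mul_zero] at this
  exact (inner_root_self_pos P j).ne' this

/-- Climb in height. A root that is not dominant can be raised by a simple root, which does not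
decrease its product with `a`. A dominant root `β ≠ ξ` has `⟪β, ξ⟫ > 0`, so `ξ - β` is a positive
root. -/
theorem inner_root_le_highestRoot [Nonempty ι] {a : V} (ha : ∀ j ∈ b.support, 0 ≤ ⟪P.root j, a⟫)
    (i : ι) : ⟪P.root i, a⟫ ≤ ⟪P.root (highestRoot b), a⟫ := by
  have hξ := isPos_highestRoot b
  generalize hn : (b.height (highestRoot b) - b.height i).toNat = n
  induction n using Nat.strongRecOn generalizing i with
  | ind n ih =>
    by_cases hdom : ∀ k ∈ b.support, 0 ≤ ⟪P.root k, P.root i⟫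
    · have h1 := inner_pos_of_dominant b hdom fun k hk ↦ by
        rw [real_inner_comm, ← pairingIn_nonneg_iff]
        exact inner_highestRoot_nonneg b (Base.isPos_of_mem_support hk)
      by_cases hne : i = highestRoot b
      · rw [hne]
      have h2 : 0 < P.pairingIn ℤ i (highestRoot b) := by
        rw [inner_root_root_sign] at h1
        exact_mod_cast (pos_iff_pos_of_mul_pos h1).mp
          (half_pos (inner_root_self_pos P (highestRoot b)))
      obtain ⟨k, hk⟩ := P.root_sub_root_mem_of_pairingIn_pos h2 hne
      have h3 := b.height_sub hk
      have h4 := height_le_highestRoot b i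
      have h5 : b.IsPos (P.reflectionPerm k k) := by
        rw [isPos_reflectionPerm_self, b.isPos_iff]
        omega
      have h6 := inner_root_nonneg h5 ha
      rw [root_reflectionPerm, RootPairing.reflection_apply_self, hk, neg_sub, inner_sub_left] at h6
      linarith
    · push Not at hdom
      obtain ⟨k, hk, hneg⟩ := hdom
      have hlt : P.pairingIn ℤ i k < 0 := by
        rw [← not_le, pairingIn_nonneg_iff]; exact not_le.mpr hneg
      -- Here `β + α_k = 0` is not a root, but `⟪β, a⟫ ≤ 0 ≤ ⟪ξ, a⟫`.
      by_cases hopp : P.root i = -P.root k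
      · rw [hopp, inner_neg_left]
        linarith [ha k hk, inner_root_nonneg hξ ha]
      · obtain ⟨l, hl⟩ := P.root_add_root_mem_of_pairingIn_neg hlt hopp
        have h1 := b.height_add hl
        rw [Base.height_one_of_mem_support hk] at h1
        have h2 := height_le_highestRoot b l
        have := ih _ (by omega) l rfl
        rw [hl, inner_add_left] at this
        linarith [ha k hk]

end Highest

/-! ### Words in reflections -/

section Words

variable {J X : Type*} (s : J → X → X)

/-- The prefixes of `l` applied to `z` form a gallery from `z` to its image under `l`. `foldr`
applies the last letter first, so lengthening the prefix `u` by `k` replaces `z` by `s k z`. -/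
theorem exists_sign_change (f : X → ℝ) (z : X) (hz : 0 < f z) (hne : ∀ l : List J, f (l.foldr s z) ≠ 0)
    (l : List J) (hl : f (l.foldr s z) < 0) :
    ∃ u k v, l = u ++ k :: v ∧ 0 < f (u.foldr s z) ∧ f (u.foldr s (s k z)) < 0 := by
  induction l using List.reverseRecOn with
  | nil => exact absurd hl hz.not_gt
  | append_singleton t k ih =>
    rcases lt_or_gt_of_ne (hne t) with h | h
    · obtain ⟨u, m, v, rfl, h1, h2⟩ := ih h
      exact ⟨u, m, v ++ [k], by simp, h1, h2⟩
    · exact ⟨t, k, [], rfl, h, by simpa using hl⟩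

/-- Two points of the chamber `{x | ∀ j, 0 ≤ f j x}` that are conjugate under a group generated by
reflections in the walls of the chamber are equal.  Here `z` is an inner point of the chamber. -/
theorem foldr_eq_self_of_chamber (f : J → X → ℝ) (z : X)
    (hs : ∀ j x, s j (s j x) = x) (hf : ∀ j x, f j (s j x) = -f j x)
    (hfix : ∀ j x, f j x = 0 → s j x = x) (hz : ∀ j, 0 < f j z)
    (hne : ∀ j (l : List J), f j (l.foldr s z) ≠ 0)
    (hsep : ∀ j k (l : List J), 0 < f j (l.foldr s z) → f j (l.foldr s (s k z)) < 0 →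
      ∀ x, s j (l.foldr s x) = l.foldr s (s k x))
    (hclosed : ∀ j (l : List J) a, (∀ i, 0 ≤ f i a) → f j (l.foldr s z) < 0 →
      f j (l.foldr s a) ≤ 0)
    (l : List J) {a : X} (ha : ∀ i, 0 ≤ f i a) (hla : ∀ i, 0 ≤ f i (l.foldr s a)) :
    l.foldr s a = a := by
  generalize hn : l.length = n
  induction n using Nat.strongRecOn generalizing l with
  | ind n ih =>
    cases l with
    | nil => rfl
    | cons j t =>
      rcases lt_or_gt_of_ne (hne j t) with h | h
      -- The gallery of `t` crosses the wall `j`. At the crossing `s j ∘ u = u ∘ s k`, so `j u k v`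
      -- acts as `u k k v`, that is, as `u v`.
      · obtain ⟨u, k, v, rfl, h1, h2⟩ := exists_sign_change s (f j) z (hz j) (hne j) t h
        have key : (j :: (u ++ k :: v)).foldr s a = (u ++ v).foldr s a := by
          simp only [List.foldr_cons, List.foldr_append]
          rw [hsep j k u h1 h2, hs]
        rw [key] at hla ⊢
        exact ih _ (by simp at hn ⊢; omega) _ hla rfl
      -- The image of `z` lies beyond the wall `j` but that of `a` lies in the chamber. So the
      -- latter is on the wall, and the first letter can be dropped.
      · have h0 : f j ((j :: t).foldr s a) = 0 :=
          le_antisymm (hclosed j (j :: t) a ha (by rw [List.foldr_cons, hf]; linarith)) (hla j)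
        have h1 : (j :: t).foldr s a = t.foldr s a := by
          rw [← hfix j _ h0, List.foldr_cons, hs]
        rw [h1] at hla ⊢
        exact ih _ (by simp at hn; omega) t hla rfl

theorem foldr_reverse_foldr (hs : ∀ j x, s j (s j x) = x) (l : List J) (x : X) :
    l.reverse.foldr s (l.foldr s x) = x := by
  induction l generalizing x with
  | nil => rfl
  | cons j t ih => rw [List.reverse_cons, List.foldr_append, List.foldr_cons, List.foldr_nil,
      List.foldr_cons, hs, ih]

end Words

/-! ### Affine reflections -/

section AffineReflections

/-- The reflection in the affine hyperplane `⟪α, x⟫ = k`. -/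
def affineReflection (P : RootPairing ι ℝ V V) (i : ι) (k : ℤ) (x : V) : V :=
  x - (⟪P.root i, x⟫ - k) • P.coroot i

variable (P : RootPairing ι ℝ V V) [IsEuclidean P]

theorem affineReflection_eq (i : ι) (k : ℤ) (x : V) :
    affineReflection P i k x = weylGroup.ofIdx P i • x + k • P.coroot i := by
  rw [affineReflection, ofIdx_smul_eq, sub_smul, Int.cast_smul_eq_zsmul]
  abel

theorem inner_root_affineReflection (i : ι) (k : ℤ) (x : V) :
    ⟪P.root i, affineReflection P i k x⟫ - k = -(⟪P.root i, x⟫ - k) := by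
  rw [affineReflection, inner_sub_right, inner_smul_right, inner_root_coroot_self]
  ring

theorem affineReflection_affineReflection (i : ι) (k : ℤ) (x : V) :
    affineReflection P i k (affineReflection P i k x) = x := by
  nth_rw 1 [affineReflection]
  rw [inner_root_affineReflection, affineReflection]
  module

theorem affineReflection_neg (i : ι) (k : ℤ) :
    affineReflection P (P.reflectionPerm i i) (-k) = affineReflection P i k := by
  funext x
  have h1 : P.root (P.reflectionPerm i i) = -P.root i := by simp
  have h2 : P.coroot (P.reflectionPerm i i) = -P.coroot i := by simp
  rw [affineReflection, affineReflection, h1, h2, inner_neg_left]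
  push_cast
  module

/-- An affine Weyl group element conjugates the reflection in a hyperplane to the reflection in its
image. This brings a separating hyperplane back to the alcove of `z`. -/
theorem affineReflection_smul_add (i : ι) (k m : ℤ) (w : P.weylGroup) {q : V}
    (hq : ⟪P.root i, q⟫ = m) (x : V) :
    affineReflection P i k (w • x + q) =
      w • affineReflection P (P.weylGroupToPerm w⁻¹ i) (k - m) x + q := by
  have h : P.coroot i = w • P.coroot (P.weylGroupToPerm w⁻¹ i) := by
    rw [← smul_coroot, smul_inv_smul]
  rw [affineReflection, affineReflection, smul_sub, smul_real_smul, ← h, inner_add_right, hq,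
    inner_root_smul]
  generalize w • x = y
  push_cast
  module

/-- Reflecting `x` changes the squared distance to `z` by `4 / ⟪α, α⟫` times the product in the
hypothesis. -/
theorem norm_affineReflection_sub_lt (i : ι) (k : ℤ) {x z : V}
    (h : (⟪P.root i, x⟫ - k) * (⟪P.root i, z⟫ - k) < 0) :
    ‖affineReflection P i k x - z‖ < ‖x - z‖ := by
  have h0 := inner_root_self_pos P i
  rw [← sq_lt_sq₀ (norm_nonneg _) (norm_nonneg _)]
  have e : affineReflection P i k x - z = (x - z) -
      ((⟪P.root i, x⟫ - k) * (2 / ⟪P.root i, P.root i⟫)) • P.root i := by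
    rw [affineReflection, IsEuclidean.coroot_eq, smul_smul]
    abel
  rw [e, @norm_sub_sq_real _ _ _ (x - z), norm_smul, mul_pow, inner_smul_right, inner_sub_left,
    real_inner_comm (P.root i) x, real_inner_comm (P.root i) z, ← real_inner_self_eq_norm_sq (P.root i),
    Real.norm_eq_abs, sq_abs]
  have : ‖x - z‖ ^ 2 - 2 * ((⟪P.root i, x⟫ - k) * (2 / ⟪P.root i, P.root i⟫) *
      (⟪P.root i, x⟫ - ⟪P.root i, z⟫)) +
      ((⟪P.root i, x⟫ - k) * (2 / ⟪P.root i, P.root i⟫)) ^ 2 * ⟪P.root i, P.root i⟫ =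
      ‖x - z‖ ^ 2 + 4 / ⟪P.root i, P.root i⟫ * ((⟪P.root i, x⟫ - k) * (⟪P.root i, z⟫ - k)) := by
    field_simp
    ring
  rw [this]
  have := mul_neg_of_pos_of_neg (div_pos four_pos h0) h
  linarith

end AffineReflections

/-! ### The walls of the fundamental domain -/

section Walls

variable [Finite ι] [Nonempty ι] {P : RootPairing ι ℝ V V} (b : P.Base)

/-- The root that defines a wall of the fundamental domain; `none` is the affine wall. -/
def wallRoot : Option b.support → ι
  | none => highestRoot b
  | some i => i

/-- The level of a wall of the fundamental domain. -/
def wallLevel : Option b.support → ℤ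
  | none => 1
  | some _ => 0

/-- The sign that makes a wall functional nonnegative on the fundamental domain. -/
def wallSign : Option b.support → ℝ
  | none => -1
  | some _ => 1

/-- The affine functional of a wall of the fundamental domain. -/
def wallFun (j : Option b.support) (x : V) : ℝ :=
  wallSign b j * (⟪P.root (wallRoot b j), x⟫ - wallLevel b j)

/-- The reflection in a wall of the fundamental domain. -/
def wallReflection (j : Option b.support) : V → V :=
  affineReflection P (wallRoot b j) (wallLevel b j)

theorem mem_fundamentalDomain_iff {a : V} :
    a ∈ fundamentalDomain P b ↔ ∀ j, 0 ≤ wallFun b j a := by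
  simp [fundamentalDomain, Option.forall, wallFun, wallSign, wallRoot, wallLevel, and_comm]

/-- The inner points of the fundamental domain. -/
def IsAlcovePoint (z : V) : Prop := ∀ i, b.IsPos i → 0 < ⟪P.root i, z⟫ ∧ ⟪P.root i, z⟫ < 1

theorem wallSign_mul_self (j : Option b.support) : wallSign b j * wallSign b j = 1 := by
  cases j <;> simp [wallSign]

variable [P.IsCrystallographic]

theorem exists_isAlcovePoint [P.IsRootSystem] : ∃ z, IsAlcovePoint b z := by
  classical
  obtain ⟨e, he⟩ := exists_dual_basis b.toWeightBasis
  have hξ : (0 : ℝ) < b.height (highestRoot b) := by exact_mod_cast isPos_highestRoot b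
  -- The sum of the fundamental coweights takes the value `ht β` on `β`; this scaling puts the
  -- values on positive roots strictly between `0` and `1`.
  let ε : ℝ := 1 / (b.height (highestRoot b) + 1)
  have hε : 0 < ε := by positivity
  refine ⟨ε • ∑ i, e i, fun i hi ↦ ?_⟩
  have h : ⟪P.root i, ε • ∑ i, e i⟫ = b.height i * ε := by
    refine inner_root_eq_height_mul (fun j hj ↦ ?_) i
    rw [inner_smul_right, inner_sum]
    have : ∀ k, ⟪P.root j, e k⟫ = if ⟨j, hj⟩ = k then 1 else 0 := by
      intro k
      rw [← he k ⟨j, hj⟩, real_inner_comm, Base.toWeightBasis_apply]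
    simp [this]
  rw [b.isPos_iff] at hi
  have hi' : (0 : ℝ) < b.height i := by exact_mod_cast hi
  have hle : (b.height i : ℝ) ≤ b.height (highestRoot b) := by
    exact_mod_cast height_le_highestRoot b i
  rw [h]
  refine ⟨by positivity, ?_⟩
  rw [mul_one_div, div_lt_one (by positivity)]
  linarith

variable {b} in
theorem wallRoot_isPos (j : Option b.support) : b.IsPos (wallRoot b j) := by
  cases j with
  | none => exact isPos_highestRoot b
  | some i => exact Base.isPos_of_mem_support i.2

variable {b} in
theorem IsAlcovePoint.wallFun_pos {z : V} (hz : IsAlcovePoint b z) (j : Option b.support) :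
    0 < wallFun b j z := by
  have := hz _ (wallRoot_isPos j)
  cases j with
  | none => simp only [wallFun, wallSign, wallLevel]; push_cast; linarith
  | some i => simp only [wallFun, wallSign, wallLevel]; push_cast; linarith

variable {b} in
theorem IsAlcovePoint.inner_neg {z : V} (hz : IsAlcovePoint b z) {i : ι} (hi : ¬ b.IsPos i) :
    ⟪P.root i, z⟫ < 0 ∧ -1 < ⟪P.root i, z⟫ := by
  have := hz _ ((isPos_reflectionPerm_self b i).mpr hi)
  rw [root_reflectionPerm, RootPairing.reflection_apply_self, inner_neg_left] at this
  constructor <;> linarith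

variable {b} in
theorem IsAlcovePoint.inner_ne_int {z : V} (hz : IsAlcovePoint b z) (i : ι) (k : ℤ) :
    ⟪P.root i, z⟫ ≠ k := by
  intro h
  by_cases hi : b.IsPos i
  · have := hz i hi
    rw [h] at this
    norm_cast at this
    omega
  · have := hz.inner_neg hi
    rw [h] at this
    norm_cast at this
    omega

variable [IsEuclidean P] [P.IsReduced]

variable {b} in
/-- A wall is the only hyperplane that separates the alcove from its image under the reflection in
this wall. -/
theorem IsAlcovePoint.affineReflection_eq_wallReflection {z : V} (hz : IsAlcovePoint b z)
    (j : Option b.support) (i : ι) (k : ℤ)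
    (h : (⟪P.root i, z⟫ - k) * (⟪P.root i, wallReflection b j z⟫ - k) < 0) :
    affineReflection P i k = wallReflection b j := by
  have main : ∀ i, b.IsPos i → ∀ k : ℤ,
      (⟪P.root i, z⟫ - k) * (⟪P.root i, wallReflection b j z⟫ - k) < 0 →
      affineReflection P i k = wallReflection b j := by
    intro i hi k h
    have hzi := hz i hi
    by_cases hij : i = wallRoot b j
    · subst hij
      have h1 := inner_root_affineReflection P (wallRoot b j) (wallLevel b j) z
      change ⟪P.root _, wallReflection b j z⟫ - _ = _ at h1
      suffices k = wallLevel b j by rw [this]; rfl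
      -- For hyperplanes parallel to the wall: `t` lies in `(0, 1)` and its mirror value `2 *
      -- wallLevel b j - t` lies in `(1, 2)` or `(-1, 0)`, so the level of the wall is the only
      -- integer between them.
      set t := ⟪P.root (wallRoot b j), z⟫
      have h2 : (t - k) * (2 * wallLevel b j - t - k) < 0 := by
        convert h using 2; linarith
      cases j with
      | none =>
        simp only [wallLevel] at h2 ⊢
        push_cast at h2
        by_contra hk
        rcases lt_or_gt_of_ne hk with hk | hk
        · have : (k : ℝ) ≤ 0 := by exact_mod_cast (by omega : k ≤ 0)
          nlinarith
        · have : (2 : ℝ) ≤ k := by exact_mod_cast hk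
          nlinarith
      | some i =>
        simp only [wallLevel] at h2 ⊢
        push_cast at h2
        by_contra hk
        rcases lt_or_gt_of_ne hk with hk | hk
        · have : (k : ℝ) ≤ -1 := by exact_mod_cast (by omega : k ≤ -1)
          nlinarith
        · have : (1 : ℝ) ≤ k := by exact_mod_cast hk
          nlinarith
    · exfalso
      -- A simple reflection permutes the other positive roots. At the affine wall the value is `⟪β,
      -- z⟫` or `1 - ⟪ξ - β, z⟫`, with `ξ - β` a positive root. In all cases no integer separates
      -- the two values.
      have h3 : 0 < ⟪P.root i, wallReflection b j z⟫ ∧ ⟪P.root i, wallReflection b j z⟫ < 1 := by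
        cases j with
        | some m =>
          have hpos := hz _ (hi.reflectionPerm m.2 hij)
          have : ⟪P.root i, wallReflection b (some m) z⟫ = ⟪P.root (P.reflectionPerm m i), z⟫ := by
            rw [wallReflection, wallRoot, wallLevel, affineReflection_eq, zero_smul, add_zero]
            have hinv : (weylGroup.ofIdx P (m : ι))⁻¹ = weylGroup.ofIdx P (m : ι) :=
              Subtype.ext (Equiv.reflection_inv P (m : ι))
            rw [inner_root_smul, hinv]
            rfl
          rwa [this]
        | none =>
          have hc : ⟪P.root i, wallReflection b none z⟫ = ⟪P.root i, z⟫ -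
              (⟪P.root (highestRoot b), z⟫ - 1) * (P.pairingIn ℤ i (highestRoot b) : ℝ) := by
            rw [wallReflection, wallRoot, wallLevel, affineReflection, inner_sub_right,
              inner_smul_right, inner_root_coroot]
            push_cast
            rfl
          rcases pairingIn_highestRoot b hi hij with h0 | ⟨h1, l, hl, hle⟩
          · rw [hc, h0]
            simpa using hzi
          · have h4 := hz l hl
            rw [hle, inner_sub_left] at h4
            rw [hc, h1]
            push_cast
            constructor <;> linarith
      rcases le_or_gt k 0 with hk | hk
      · have : (k : ℝ) ≤ 0 := by exact_mod_cast hk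
        nlinarith
      · have : (1 : ℝ) ≤ k := by exact_mod_cast hk
        nlinarith
  by_cases hi : b.IsPos i
  · exact main i hi k h
  · rw [← affineReflection_neg]
    refine main _ ((isPos_reflectionPerm_self b i).mpr hi) _ ?_
    rw [root_reflectionPerm, RootPairing.reflection_apply_self, inner_neg_left, inner_neg_left]
    push_cast
    linarith

variable {b} in
theorem wallReflection_word (l : List (Option b.support)) :
    ∃ w : P.weylGroup, ∃ q ∈ corootLattice P,
      ∀ x, l.foldr (wallReflection b) x = w • x + q := by
  induction l with
  | nil => exact ⟨1, 0, zero_mem _, fun x ↦ by rw [one_smul, add_zero]; rfl⟩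
  | cons j t ih =>
    obtain ⟨w, q, hq, h⟩ := ih
    refine ⟨weylGroup.ofIdx P (wallRoot b j) * w, weylGroup.ofIdx P (wallRoot b j) • q +
      wallLevel b j • P.coroot (wallRoot b j), add_mem (IsWeylStable.smul_mem _ hq)
        (zsmul_mem (coroot_mem_corootLattice P _) _), fun x ↦ ?_⟩
    rw [List.foldr_cons, h, wallReflection, affineReflection_eq, smul_add, mul_smul, add_assoc]

variable [P.IsIrreducible]

variable {b} in
theorem inner_root_mem_Icc {i : ι} (hi : b.IsPos i) {a : V} (ha : a ∈ fundamentalDomain P b) :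
    0 ≤ ⟪P.root i, a⟫ ∧ ⟪P.root i, a⟫ ≤ 1 :=
  ⟨inner_root_nonneg hi ha.1, (inner_root_le_highestRoot b ha.1 i).trans ha.2⟩

variable {b} in
-- No hyperplane of integer level cuts the interior of `F`: for a positive root the values lie in
-- `(0, 1)` at `z` and in `[0, 1]` on `F`.
theorem IsAlcovePoint.inner_le {z : V} (hz : IsAlcovePoint b z) {a : V}
    (ha : a ∈ fundamentalDomain P b) {i : ι} {k : ℤ} (h : ⟪P.root i, z⟫ < k) :
    ⟪P.root i, a⟫ ≤ k := by
  by_cases hi : b.IsPos i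
  · have h1 : (0 : ℝ) < k := (hz i hi).1.trans h
    have h2 : (1 : ℝ) ≤ k := by exact_mod_cast (by exact_mod_cast h1 : 0 < k)
    exact (inner_root_mem_Icc hi ha).2.trans h2
  · have h1 : (-1 : ℝ) < k := (hz.inner_neg hi).2.trans h
    have h2 : (0 : ℝ) ≤ k := by exact_mod_cast (by exact_mod_cast h1 : -1 < k)
    have h3 := (inner_root_mem_Icc ((isPos_reflectionPerm_self b i).mpr hi) ha).1
    rw [root_reflectionPerm, RootPairing.reflection_apply_self, inner_neg_left] at h3
    linarith

variable {b} in
theorem IsAlcovePoint.le_inner {z : V} (hz : IsAlcovePoint b z) {a : V}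
    (ha : a ∈ fundamentalDomain P b) {i : ι} {k : ℤ} (h : (k : ℝ) < ⟪P.root i, z⟫) :
    (k : ℝ) ≤ ⟪P.root i, a⟫ := by
  have := hz.inner_le ha (i := P.reflectionPerm i i) (k := -k) (by
    rw [root_reflectionPerm, RootPairing.reflection_apply_self, inner_neg_left]
    push_cast; linarith)
  rw [root_reflectionPerm, RootPairing.reflection_apply_self, inner_neg_left] at this
  push_cast at this
  linarith

/-- Two points of the fundamental domain that are conjugate under the group generated by the wall
reflections are equal. -/
theorem wallReflection_word_eq_self [P.IsRootSystem] (l : List (Option b.support)) {a : V}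
    (ha : a ∈ fundamentalDomain P b)
    (hla : l.foldr (wallReflection b) a ∈ fundamentalDomain P b) :
    l.foldr (wallReflection b) a = a := by
  obtain ⟨z, hz⟩ := exists_isAlcovePoint b
  -- A wall functional composed with a word is, up to sign, a root minus an integer level, so the
  -- statements about hyperplanes and `z` apply to it.
  have word : ∀ (j) (l : List (Option b.support)), ∃ w : P.weylGroup, ∃ q, ∃ m : ℤ,
      (∀ x, l.foldr (wallReflection b) x = w • x + q) ∧ ⟪P.root (wallRoot b j), q⟫ = m ∧
      ∀ x, wallFun b j (l.foldr (wallReflection b) x) = wallSign b j *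
        (⟪P.root (P.weylGroupToPerm w⁻¹ (wallRoot b j)), x⟫ - (wallLevel b j - m : ℤ)) := by
    intro j l
    obtain ⟨w, q, hq, h⟩ := wallReflection_word l
    obtain ⟨m, hm⟩ := exists_inner_root_eq_int P hq (wallRoot b j)
    refine ⟨w, q, m, h, hm, fun x ↦ ?_⟩
    rw [h, wallFun, inner_add_right, inner_root_smul, hm]
    push_cast
    ring
  have sign : ∀ j, wallSign b j = 1 ∨ wallSign b j = -1 := by
    intro j; cases j <;> simp [wallSign]
  refine foldr_eq_self_of_chamber (wallReflection b) (wallFun b) z ?_ ?_ ?_ hz.wallFun_pos ?_ ?_ ?_ l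
    ((mem_fundamentalDomain_iff b).mp ha) ((mem_fundamentalDomain_iff b).mp hla)
  · exact fun j x ↦ affineReflection_affineReflection P _ _ x
  · intro j x
    rw [wallFun, wallReflection, inner_root_affineReflection, wallFun, mul_neg]
  · intro j x h
    have h0 : wallSign b j ≠ 0 := by rcases sign j with h | h <;> rw [h] <;> norm_num
    rw [wallReflection, affineReflection, (mul_eq_zero.mp h).resolve_left h0, zero_smul, sub_zero]
  · intro j l
    obtain ⟨w, q, m, -, -, hx⟩ := word j l
    rw [hx]
    refine mul_ne_zero ?_ (sub_ne_zero.mpr (hz.inner_ne_int _ _))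
    rcases sign j with h | h <;> rw [h] <;> norm_num
  · intro j k l h1 h2 x
    obtain ⟨w, q, m, hw, hm, hx⟩ := word j l
    rw [hx] at h1 h2
    have hmul := mul_neg_of_pos_of_neg h1 h2
    rw [mul_mul_mul_comm, wallSign_mul_self, one_mul] at hmul
    rw [hw, hw, ← hz.affineReflection_eq_wallReflection k _ _ hmul, wallReflection,
      affineReflection_smul_add P _ _ m w hm]
  · intro j l a ha h
    obtain ⟨w, q, m, -, -, hx⟩ := word j l
    rw [hx] at h ⊢
    rw [← mem_fundamentalDomain_iff] at ha
    rcases sign j with hj | hj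
    · rw [hj, one_mul] at h ⊢
      linarith [hz.inner_le ha (i := P.weylGroupToPerm w⁻¹ (wallRoot b j))
        (k := wallLevel b j - m) (by linarith)]
    · rw [hj] at h ⊢
      linarith [hz.le_inner ha (i := P.weylGroupToPerm w⁻¹ (wallRoot b j))
        (k := wallLevel b j - m) (by linarith)]

end Walls

/-! ### The affine Weyl group is generated by the wall reflections -/

section Generation

variable [Finite ι] [Nonempty ι] {P : RootPairing ι ℝ V V} (b : P.Base)
  [P.IsCrystallographic] [IsEuclidean P]

/-- The maps that are products of wall reflections. -/
def IsWallWord (g : V → V) : Prop :=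
  ∃ l : List (Option b.support), ∀ x, l.foldr (wallReflection b) x = g x

variable {b} in
theorem IsWallWord.comp {g h : V → V} (hg : IsWallWord b g) (hh : IsWallWord b h) :
    IsWallWord b fun x ↦ g (h x) := by
  obtain ⟨l, hl⟩ := hg
  obtain ⟨m, hm⟩ := hh
  exact ⟨l ++ m, fun x ↦ by rw [List.foldr_append, hm, hl]⟩

theorem isWallWord_wallReflection (j : Option b.support) : IsWallWord b (wallReflection b j) :=
  ⟨[j], fun _ ↦ rfl⟩

theorem isWallWord_ofIdx_of_mem {i : ι} (hi : i ∈ b.support) :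
    IsWallWord b fun x ↦ weylGroup.ofIdx P i • x := by
  convert! isWallWord_wallReflection b (some ⟨i, hi⟩) using 2 with x
  rw [wallReflection, wallRoot, wallLevel, affineReflection_eq, zero_smul, add_zero]

/-- The translations that are products of wall reflections. -/
def wallTranslations : AddSubgroup V where
  carrier := {q | IsWallWord b fun x ↦ x + q}
  zero_mem' := ⟨[], fun x ↦ by simp⟩
  add_mem' {q r} hq hr := by
    have h : IsWallWord b fun x ↦ x + q + r := IsWallWord.comp (g := fun x ↦ x + r) hr hq
    simp only [add_assoc] at h
    exact h
  neg_mem' {q} hq := by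
    obtain ⟨l, hl⟩ := hq
    refine ⟨l.reverse, fun x ↦ ?_⟩
    have := foldr_reverse_foldr (wallReflection b)
      (fun j x ↦ affineReflection_affineReflection P _ _ x) l (x + -q)
    rw [hl] at this
    simpa using this

/-- The linear reflection `r_ξ` followed by the reflection in the parallel affine wall is the
translation by `ξ^∨`. -/
theorem coroot_highestRoot_mem_wallTranslations [P.IsReduced]
    (hW : ∀ w : P.weylGroup, IsWallWord b fun x ↦ w • x) :
    P.coroot (highestRoot b) ∈ wallTranslations b := by
  change IsWallWord b _
  convert! (isWallWord_wallReflection b none).comp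
    (hW (weylGroup.ofIdx P (highestRoot b))) using 2 with x
  have hinv : (weylGroup.ofIdx P (highestRoot b))⁻¹ = weylGroup.ofIdx P (highestRoot b) :=
    Subtype.ext (Equiv.reflection_inv P (highestRoot b))
  rw [wallReflection, wallRoot, wallLevel, affineReflection_eq, one_smul]
  nth_rw 1 [← hinv]
  rw [inv_smul_smul]

variable [P.IsReduced]

theorem isWallWord_weylGroup (w : P.weylGroup) : IsWallWord b fun x ↦ w • x := by
  have conj : ∀ i j, weylGroup.ofIdx P (P.reflectionPerm j i) =
      weylGroup.ofIdx P j * weylGroup.ofIdx P i * weylGroup.ofIdx P j := by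
    intro i j
    apply Subtype.ext
    apply Equiv.weightHom_injective P
    ext x
    change P.reflection (P.reflectionPerm j i) x =
      P.reflection j (P.reflection i (P.reflection j x))
    rw [reflection_reflectionPerm]
    rfl
  have all : ∀ i, IsWallWord b fun x ↦ weylGroup.ofIdx P i • x := by
    intro i
    refine b.induction_reflect i ?_ (fun i hi ↦ isWallWord_ofIdx_of_mem b hi) ?_
    · intro i hi
      simp only [conj, mul_smul]
      exact hi.comp (hi.comp hi)
    · intro i j hi hj
      simp only [conj, mul_smul]
      have h := isWallWord_ofIdx_of_mem b hj
      exact h.comp (hi.comp h)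
  obtain ⟨g, hg⟩ := w
  induction hg using weylGroup.induction with
  | mem i => exact all i
  | one => exact ⟨[], fun _ ↦ rfl⟩
  | mul x y hx hy h1 h2 => exact h1.comp h2

theorem smul_mem_wallTranslations (w : P.weylGroup) {q : V} (hq : q ∈ wallTranslations b) :
    w • q ∈ wallTranslations b := by
  change IsWallWord b _
  convert! (isWallWord_weylGroup b w).comp
    (IsWallWord.comp (g := fun x ↦ x + q) hq (isWallWord_weylGroup b w⁻¹)) using 2 with x
  rw [smul_add, smul_inv_smul]

/-- For a positive `β ≠ ξ` not orthogonal to `ξ`, `⟪β, ξ^∨⟫ = 1` gives `β^∨ = ξ^∨ - r_β ξ^∨`. By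
irreducibility the orbit of `ξ` spans `V`, so every root has a conjugate that is not orthogonal to
`ξ`. -/
theorem coroot_mem_wallTranslations [P.IsIrreducible] (i : ι) :
    P.coroot i ∈ wallTranslations b := by
  have hξ := coroot_highestRoot_mem_wallTranslations b (isWallWord_weylGroup b)
  have pos : ∀ i, b.IsPos i → ⟪P.root i, P.root (highestRoot b)⟫ ≠ 0 →
      P.coroot i ∈ wallTranslations b := by
    intro i hi h
    by_cases hne : i = highestRoot b
    · rwa [hne]
    rcases pairingIn_highestRoot b hi hne with h0 | ⟨h1, -⟩
    · rw [inner_root_root_sign, h0, Int.cast_zero, mul_zero] at h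
      exact absurd rfl h
    · have h2 := sub_mem hξ (smul_mem_wallTranslations b (weylGroup.ofIdx P i) hξ)
      rwa [ofIdx_smul_eq, inner_root_coroot, h1, Int.cast_one, one_smul, sub_sub_cancel] at h2
  have key : ∀ i, ⟪P.root i, P.root (highestRoot b)⟫ ≠ 0 → P.coroot i ∈ wallTranslations b := by
    intro i h
    by_cases hi : b.IsPos i
    · exact pos i hi h
    · have := pos _ ((isPos_reflectionPerm_self b i).mpr hi) (by
        rwa [root_reflectionPerm, RootPairing.reflection_apply_self, inner_neg_left, neg_ne_zero])
      have h2 : P.coroot (P.reflectionPerm i i) = -P.coroot i := by simp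
      rwa [h2, neg_mem_iff] at this
  obtain ⟨w, hw⟩ : ∃ w : P.weylGroup, ⟪P.root i, w • P.root (highestRoot b)⟫ ≠ 0 := by
    by_contra! h
    have hle : Submodule.span ℝ (MulAction.orbit P.weylGroup (P.root (highestRoot b))) ≤
        LinearMap.ker (innerₗ V (P.root i)) := by
      refine Submodule.span_le.mpr ?_
      rintro _ ⟨w, rfl⟩
      exact h w
    rw [span_orbit_eq_top] at hle
    exact (inner_root_self_pos P i).ne' (hle Submodule.mem_top)
  rw [inner_root_smul] at hw
  have := smul_mem_wallTranslations b w (key _ hw)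
  rwa [← smul_coroot, smul_inv_smul] at this

theorem isWallWord_affine [P.IsIrreducible] (w : P.weylGroup) {q : V} (hq : q ∈ corootLattice P) :
    IsWallWord b fun x ↦ w • x + q := by
  have h : q ∈ wallTranslations b := by
    have hle : P.corootSpan ℤ ≤ (wallTranslations b).toIntSubmodule := by
      refine Submodule.span_le.mpr ?_
      rintro _ ⟨i, rfl⟩
      exact coroot_mem_wallTranslations b i
    exact hle hq
  exact IsWallWord.comp (g := fun x ↦ x + q) h (isWallWord_weylGroup b w)

end Generation

/-! ### The fundamental domain is a strict fundamental domain -/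

section FundamentalDomain

variable [Finite ι] [Nonempty ι] {P : RootPairing ι ℝ V V} (b : P.Base) [P.IsRootSystem]
  [P.IsCrystallographic] [P.IsReduced] [P.IsIrreducible] [IsEuclidean P]

theorem eq_of_mem_fundamentalDomain (w : P.weylGroup) {q : V} (hq : q ∈ corootLattice P) {a : V}
    (ha : a ∈ fundamentalDomain P b) (ha' : w • a + q ∈ fundamentalDomain P b) :
    w • a + q = a := by
  obtain ⟨l, hl⟩ := isWallWord_affine b w hq
  replace hl : l.foldr (wallReflection b) a = w • a + q := hl a
  rw [← hl] at ha' ⊢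
  exact wallReflection_word_eq_self b l ha ha'

theorem corootSpan_eq_span_basis :
    P.corootSpan ℤ = Submodule.span ℤ (Set.range b.toCoweightBasis) := by
  have : Set.range b.toCoweightBasis = P.coroot '' b.support := by
    ext x
    simp
  rw [this, b.span_int_coroot_support]

/-- Take an orbit point nearest to `z`. Were it on the wrong side of a wall, its reflection in that
wall would be nearer. -/
theorem exists_mem_fundamentalDomain (x : V) :
    ∃ w : P.weylGroup, ∃ q ∈ corootLattice P, w • x + q ∈ fundamentalDomain P b := by
  obtain ⟨z, hz⟩ := exists_isAlcovePoint b
  have : FiniteDimensional ℝ V := b.toCoweightBasis.finiteDimensional_of_finite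
  let A : Set V := {y | (∃ w : P.weylGroup, ∃ q ∈ corootLattice P, y = w • x + q) ∧
    ‖y - z‖ ≤ ‖x - z‖}
  -- `W` is finite, and a ball contains only finitely many points of the lattice `Q^∨`.
  have hA : A.Finite := by
    refine Set.Finite.subset (Set.finite_iUnion fun w : P.weylGroup ↦
      (((ZSpan.setFinite_inter b.toCoweightBasis (s := Metric.closedBall (z - w • x) ‖x - z‖)
        Metric.isBounded_closedBall)).image fun q ↦ w • x + q)) ?_
    rintro _ ⟨⟨w, q, hq, rfl⟩, h⟩
    refine Set.mem_iUnion.mpr ⟨w, q, ⟨?_, ?_⟩, rfl⟩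
    · rw [mem_closedBall_iff_norm]
      convert! h using 2
      abel
    · rw [← corootSpan_eq_span_basis]
      exact hq
  obtain ⟨y, ⟨⟨w, q, hq, rfl⟩, hy⟩, hmin⟩ := A.exists_min_image (fun y ↦ ‖y - z‖) hA
    ⟨x, ⟨1, 0, zero_mem _, by rw [one_smul, add_zero]⟩, le_rfl⟩
  refine ⟨w, q, hq, (mem_fundamentalDomain_iff b).mpr fun j ↦ ?_⟩
  by_contra! hneg
  have hlt := norm_affineReflection_sub_lt P (wallRoot b j) (wallLevel b j) (x := w • x + q)
    (z := z) (by
      have := mul_neg_of_neg_of_pos hneg (hz.wallFun_pos j)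
      rwa [wallFun, wallFun, mul_mul_mul_comm, wallSign_mul_self, one_mul] at this)
  refine (hmin (affineReflection P (wallRoot b j) (wallLevel b j) (w • x + q))
    ⟨⟨weylGroup.ofIdx P (wallRoot b j) * w, weylGroup.ofIdx P (wallRoot b j) • q +
      wallLevel b j • P.coroot (wallRoot b j), add_mem (IsWeylStable.smul_mem _ hq)
        (zsmul_mem (coroot_mem_corootLattice P _) _), ?_⟩, hlt.le.trans hy⟩).not_gt hlt
  rw [affineReflection_eq, smul_add, mul_smul, add_assoc]

/-- The reflections in `α` and in `α^∨` are the same map. -/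
theorem exists_weylGroup_flip (w : P.weylGroup) :
    ∃ w' : P.flip.weylGroup, ∀ x : V, w' • x = w • x := by
  obtain ⟨g, hg⟩ := w
  induction hg using weylGroup.induction with
  | mem i =>
    refine ⟨weylGroup.ofIdx P.flip i, fun x ↦ ?_⟩
    have h := ofIdx_smul_eq P i x
    have h' := ofIdx_smul_eq P.flip i x
    rw [h']
    refine Eq.trans ?_ h.symm
    change x - ⟪P.coroot i, x⟫ • P.root i = _
    rw [IsEuclidean.coroot_eq, inner_smul_left, smul_smul]
    simp only [conj_trivial]
    rw [mul_comm]
  | one => exact ⟨1, fun x ↦ rfl⟩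
  | mul x y hx hy h1 h2 =>
    obtain ⟨u, hu⟩ := h1
    obtain ⟨v, hv⟩ := h2
    exact ⟨u * v, fun a ↦ by rw [mul_smul, hv, hu]; rfl⟩

theorem eq_of_mem_dualFundamentalDomain (w : P.weylGroup) {q : V} (hq : q ∈ rootLattice P) {a : V}
    (ha : a ∈ dualFundamentalDomain P b) (ha' : w • a + q ∈ dualFundamentalDomain P b) :
    w • a + q = a := by
  obtain ⟨w', hw'⟩ := exists_weylGroup_flip w
  rw [← hw'] at ha' ⊢
  exact eq_of_mem_fundamentalDomain b.flip w' hq ha ha'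

end FundamentalDomain

/-! ### The order of the group `(1/M) P^∨ / Q^∨` -/

section Index

variable (P : RootPairing ι ℝ V V)

/-- The lattice `(1/M) P^∨`. -/
def fractionalCoweightLattice (M : ℕ) : AddSubgroup V :=
  (coweightLattice P).comap (nsmulAddMonoidHom M)

/-- The group `(1/M) P^∨ / Q^∨`. -/
def torusGrid (M : ℕ) : AddSubgroup (V ⧸ corootLattice P) :=
  (fractionalCoweightLattice P M).map (QuotientAddGroup.mk' (corootLattice P))

variable {P} (b : P.Base)

theorem mem_coweightLattice_iff {x : V} :
    x ∈ coweightLattice P ↔ ∀ i : b.support, ∃ k : ℤ, ⟪x, P.root i⟫ = k := by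
  refine ⟨fun h i ↦ h _ (Submodule.subset_span ⟨_, rfl⟩), fun h y hy ↦ ?_⟩
  replace hy : y ∈ Submodule.span ℤ (P.root '' b.support) := b.span_int_root_support ▸ hy
  induction hy using Submodule.span_induction with
  | mem y h' =>
    obtain ⟨i, hi, rfl⟩ := h'
    exact h ⟨i, hi⟩
  | zero => exact ⟨0, by simp⟩
  | add x y _ _ hx hy =>
    obtain ⟨k, hk⟩ := hx
    obtain ⟨l, hl⟩ := hy
    exact ⟨k + l, by rw [inner_add_right, hk, hl]; push_cast; rfl⟩
  | smul a x _ hx =>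
    obtain ⟨k, hk⟩ := hx
    exact ⟨a * k, by rw [← Int.cast_smul_eq_zsmul ℝ, inner_smul_right, hk]; push_cast; rfl⟩

/-- The basis of `(1/M) P^∨` that is dual to the vectors `M α_i`. -/
theorem exists_basis_fractionalCoweightLattice [P.IsRootSystem] {M : ℕ} (hM : 0 < M) :
    ∃ e : Basis b.support ℝ V, (∀ x i, e.repr x i = M * ⟪x, P.root i⟫) ∧
      (∀ x, x = ∑ i, ⟪x, e i⟫ • (M • P.root i)) ∧
      (fractionalCoweightLattice P M).toIntSubmodule = Submodule.span ℤ (Set.range e) := by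
  classical
  have hM0 : (M : ℝ) ≠ 0 := by exact_mod_cast hM.ne'
  let v := b.toWeightBasis.unitsSMul fun _ ↦ Units.mk0 (M : ℝ) hM0
  have hv : ∀ i, v i = (M : ℝ) • P.root i := by
    intro i
    simp [v, Basis.unitsSMul_apply, Units.smul_def]
  obtain ⟨e, he⟩ := exists_dual_basis v
  have hrepr : ∀ x i, e.repr x i = M * ⟪x, P.root i⟫ := by
    intro x i
    rw [← inner_smul_right, ← hv]
    conv_rhs => rw [← e.sum_repr x, sum_inner]
    simp [inner_smul_left, he]
  refine ⟨e, hrepr, fun x ↦ ?_, ?_⟩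
  · have : ∀ i, ⟪x, e i⟫ = v.repr x i := by
      intro i
      conv_lhs => rw [← v.sum_repr x, sum_inner]
      simp [inner_smul_left, he, real_inner_comm]
    simp only [this, ← Nat.cast_smul_eq_nsmul ℝ, ← hv]
    exact (v.sum_repr x).symm
  · ext x
    rw [Basis.mem_span_iff_repr_mem]
    change M • x ∈ coweightLattice P ↔ _
    rw [mem_coweightLattice_iff b]
    refine forall_congr' fun i ↦ ?_
    rw [hrepr, ← Nat.cast_smul_eq_nsmul ℝ, inner_smul_left]
    simp [eq_comm]

variable [Finite ι] [P.IsRootSystem] [P.IsCrystallographic] [IsEuclidean P]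

/-- The Cartan matrix is the Gram matrix of the simple roots times a positive diagonal matrix.
Positivity removes the absolute value from the index formula. -/
theorem det_cartanMatrix_pos [DecidableEq b.support] : 0 < b.cartanMatrix.det := by
  have hC : b.cartanMatrix.map (Int.cast : ℤ → ℝ) =
      Matrix.gram ℝ (fun i : b.support ↦ P.root i) *
        Matrix.diagonal fun i : b.support ↦ 2 / ⟪P.root i, P.root i⟫ := by
    ext i j
    rw [Matrix.mul_diagonal, Matrix.gram_apply, Matrix.map_apply,
      show b.cartanMatrix i j = P.pairingIn ℤ i j from rfl, ← inner_root_coroot,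
      IsEuclidean.coroot_eq, inner_smul_right, mul_comm]
  have hdet : (b.cartanMatrix.det : ℝ) = (b.cartanMatrix.map (Int.cast : ℤ → ℝ)).det :=
    (Int.castRingHom ℝ).map_det _
  have hpos : 0 < (b.cartanMatrix.det : ℝ) := by
    rw [hdet, hC, Matrix.det_mul, Matrix.det_diagonal]
    exact mul_pos (Matrix.posDef_gram_of_linearIndependent b.linearIndepOn_root).det_pos
      (Finset.prod_pos fun i _ ↦ div_pos two_pos (inner_root_self_pos P i))
  exact_mod_cast hpos

theorem corootLattice_le_fractionalCoweightLattice (M : ℕ) :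
    corootLattice P ≤ fractionalCoweightLattice P M := by
  intro q hq
  refine AddSubgroup.nsmul_mem (coweightLattice P) (x := q) ?_ M
  intro y hy
  change y ∈ Submodule.span ℤ _ at hy
  induction hy using Submodule.span_induction with
  | mem y h =>
    obtain ⟨i, rfl⟩ := h
    rw [real_inner_comm]
    exact exists_inner_root_eq_int P hq i
  | zero => exact ⟨0, by simp⟩
  | add x y _ _ hx hy =>
    obtain ⟨k, hk⟩ := hx
    obtain ⟨l, hl⟩ := hy
    exact ⟨k + l, by rw [inner_add_right, hk, hl]; push_cast; rfl⟩
  | smul a x _ hx =>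
    obtain ⟨k, hk⟩ := hx
    exact ⟨a * k, by rw [← Int.cast_smul_eq_zsmul ℝ, inner_smul_right, hk]; push_cast; rfl⟩

/-- The index of `Q^∨` in `(1/M) P^∨` is a determinant: in the basis dual to the `M α_i`, the simple
coroots have the coordinates `M ⟪α_i, α_j^∨⟫`. -/
theorem card_torusGrid [DecidableEq b.support] {M : ℕ} (hM : 0 < M) :
    (Nat.card (torusGrid P M) : ℤ) = b.cartanMatrix.det * M ^ finrank ℝ V := by
  have hle := corootLattice_le_fractionalCoweightLattice (P := P) M
  have hcard : Nat.card (torusGrid P M) =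
      (corootLattice P).relIndex (fractionalCoweightLattice P M) := by
    rw [torusGrid, ← AddSubgroup.relIndex_ker, QuotientAddGroup.ker_mk']
  obtain ⟨e, hrepr, -, hspan⟩ := exists_basis_fractionalCoweightLattice b hM
  let b₁ : Basis b.support ℤ (corootLattice P).toIntSubmodule := b.flip.toWeightBasisInt
  have hb₁ : ∀ i, (b₁ i : V) = P.coroot i := fun i ↦ b.flip.coe_toWeightBasisInt_apply i
  let b₂ : Basis b.support ℤ (fractionalCoweightLattice P M).toIntSubmodule :=
    (e.restrictScalars ℤ).map (LinearEquiv.ofEq _ _ hspan.symm)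
  have hb₂ : ∀ x i, ((b₂.repr x i : ℤ) : ℝ) = M * ⟪(x : V), P.root i⟫ := by
    intro x i
    rw [← hrepr, Basis.map_repr, LinearEquiv.trans_apply]
    exact e.restrictScalars_repr_apply ℤ _ i
  rw [hcard, AddSubgroup.relIndex_eq_natAbs_det _ _ hle b₁ b₂, Basis.det_apply]
  have hmat : b₂.toMatrix (fun i ↦ ⟨b₁ i, hle (SetLike.coe_mem _)⟩) =
      (M : ℤ) • b.cartanMatrix := by
    ext i j
    have h := hb₂ ⟨b₁ j, hle (SetLike.coe_mem _)⟩ i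
    have h' : ⟪(b₁ j : V), P.root i⟫ = (b.cartanMatrix i j : ℤ) := by
      rw [hb₁, real_inner_comm, inner_root_coroot]
      rfl
    change _ = (M : ℝ) * ⟪(b₁ j : V), P.root i⟫ at h
    rw [h'] at h
    rw [Basis.toMatrix_apply, Matrix.smul_apply, smul_eq_mul]
    exact_mod_cast h
  rw [hmat, Matrix.det_smul, Module.finrank_eq_card_basis e, Int.natCast_natAbs, abs_of_pos, mul_comm]
  exact mul_pos (by positivity) (det_cartanMatrix_pos b)

theorem finite_torusGrid (b : P.Base) {M : ℕ} (hM : 0 < M) : Finite (torusGrid P M) := by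
  classical
  refine Nat.finite_of_card_ne_zero fun h ↦ ?_
  have := card_torusGrid b hM
  rw [h] at this
  have h1 : 0 < b.cartanMatrix.det * (M : ℤ) ^ finrank ℝ V :=
    mul_pos (det_cartanMatrix_pos b) (by positivity)
  rw [← this] at h1
  simp at h1

/-- The coordinates of `x` in the basis `M α_i` are its products with the dual basis of `(1/M) P^∨`.
This identifies the weights whose character is trivial on the grid. -/
theorem mem_scaledRootLattice_iff (b : P.Base) {M : ℕ} (hM : 0 < M) {x : V} :
    x ∈ scaledRootLattice P M ↔ ∀ a ∈ fractionalCoweightLattice P M, ∃ k : ℤ, ⟪x, a⟫ = k := by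
  constructor
  · rintro ⟨q, hq, rfl⟩ a ha
    obtain ⟨k, hk⟩ := ha q hq
    refine ⟨k, ?_⟩
    rw [← hk, real_inner_comm]
    change ⟪a, M • q⟫ = ⟪M • a, q⟫
    rw [← Nat.cast_smul_eq_nsmul ℝ, ← Nat.cast_smul_eq_nsmul ℝ, inner_smul_left, inner_smul_right]
    simp
  · intro h
    obtain ⟨e, -, hsum, hspan⟩ := exists_basis_fractionalCoweightLattice b hM
    rw [hsum x]
    refine sum_mem fun i _ ↦ ?_
    have he : e i ∈ (fractionalCoweightLattice P M).toIntSubmodule :=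
      hspan ▸ Submodule.subset_span ⟨i, rfl⟩
    obtain ⟨k, hk⟩ := h (e i) he
    rw [hk, Int.cast_smul_eq_zsmul]
    have hmem : M • P.root i ∈ scaledRootLattice P M :=
      ⟨P.root i, Submodule.subset_span ⟨_, rfl⟩, rfl⟩
    exact zsmul_mem hmem k

end Index

/-! ### Characters of the torus -/

section Characters

variable (P : RootPairing ι ℝ V V) [IsEuclidean P]

theorem cexp_inner_eq_one_iff (μ a : V) :
    Complex.exp (2 * Real.pi * Complex.I * (⟪μ, a⟫ : ℝ)) = 1 ↔ ∃ k : ℤ, ⟪μ, a⟫ = k := by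
  rw [Complex.exp_eq_one_iff]
  refine exists_congr fun k ↦ ?_
  have h : (2 * Real.pi * Complex.I : ℂ) ≠ 0 := Complex.two_pi_I_ne_zero
  rw [mul_comm (k : ℂ), mul_right_inj' h]
  norm_cast

theorem cexp_inner_add (μ a a' : V) :
    Complex.exp (2 * Real.pi * Complex.I * (⟪μ, a + a'⟫ : ℝ)) =
      Complex.exp (2 * Real.pi * Complex.I * (⟪μ, a⟫ : ℝ)) *
        Complex.exp (2 * Real.pi * Complex.I * (⟪μ, a'⟫ : ℝ)) := by
  rw [← Complex.exp_add, inner_add_right]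
  push_cast
  ring_nf

/-- The character `exp(2 π i ⟪μ, a⟫)` of the torus `V / Q^∨` that belongs to a weight `μ`. -/
def weightChar (μ : weightLattice P) : AddChar (V ⧸ corootLattice P) ℂ where
  toFun := Quotient.lift
    (fun a ↦ Complex.exp (2 * Real.pi * Complex.I * (⟪(μ : V), a⟫ : ℝ))) fun a a' h ↦ by
      have h' : -a + a' ∈ corootLattice P := QuotientAddGroup.leftRel_apply.mp h
      rw [← add_neg_cancel_left a a', cexp_inner_add, (cexp_inner_eq_one_iff _ _).mpr (μ.2 _ h'),
        mul_one]
  map_zero_eq_one' := by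
    change Complex.exp (2 * Real.pi * Complex.I * (⟪(μ : V), 0⟫ : ℝ)) = 1
    simp
  map_add_eq_mul' x y := by
    induction x using QuotientAddGroup.induction_on with
    | H x =>
      induction y using QuotientAddGroup.induction_on with
      | H y => exact cexp_inner_add _ x y

theorem weightChar_mk (μ : weightLattice P) (a : V) :
    weightChar P μ (a : V ⧸ corootLattice P) =
      Complex.exp (2 * Real.pi * Complex.I * (⟪(μ : V), a⟫ : ℝ)) := rfl

theorem weightChar_mul_conj (μ ν : weightLattice P) (x : V ⧸ corootLattice P) :
    weightChar P μ x * (starRingEnd ℂ) (weightChar P ν x) = weightChar P (μ - ν) x := by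
  induction x using QuotientAddGroup.induction_on with
  | H x =>
    rw [weightChar_mk, weightChar_mk, weightChar_mk, ← Complex.exp_conj, ← Complex.exp_add]
    congr 1
    simp only [map_mul, Complex.conj_ofReal, Complex.conj_I, map_ofNat, AddSubgroup.coe_sub,
      inner_sub_left, Complex.ofReal_sub]
    ring

variable {P}

theorem sum_weightChar [Finite ι] [P.IsRootSystem] [P.IsCrystallographic] (b : P.Base) {M : ℕ}
    (hM : 0 < M) [Fintype (torusGrid P M)] (μ : weightLattice P)
    [Decidable ((μ : V) ∈ scaledRootLattice P M)] :
    ∑ x : torusGrid P M, weightChar P μ x =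
      if (μ : V) ∈ scaledRootLattice P M then (Nat.card (torusGrid P M) : ℂ) else 0 := by
  classical
  have h := AddChar.sum_eq_ite
    ((weightChar P μ).compAddMonoidHom (torusGrid P M).subtype)
  refine h.trans ?_
  rw [Nat.card_eq_fintype_card]
  refine if_congr ?_ rfl rfl
  rw [mem_scaledRootLattice_iff b hM, AddChar.eq_zero_iff]
  constructor
  · intro h a ha
    exact (cexp_inner_eq_one_iff _ _).mp (h ⟨(a : V ⧸ corootLattice P), a, ha, rfl⟩)
  · rintro h ⟨_, a, ha, rfl⟩
    exact (cexp_inner_eq_one_iff _ _).mpr (h a ha)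

variable (P)

/-- The action of the Weyl group on a weight. -/
def smulWeight (w : P.weylGroup) (μ : weightLattice P) : weightLattice P :=
  ⟨w • (μ : V), smul_mem_weightLattice P w μ.2⟩

theorem torusOrbitFun_eq_sum [Fintype P.weylGroup] (σ : P.weylGroup →* ℤˣ) (μ : weightLattice P)
    (x : V ⧸ corootLattice P) :
    torusOrbitFun P σ μ x = ∑ w, ((σ w : ℤ) : ℂ) * weightChar P (smulWeight P w μ) x := by
  induction x using QuotientAddGroup.induction_on with
  | H x => exact finsum_eq_sum_of_fintype _

theorem weightChar_smul (w : P.weylGroup) (μ : weightLattice P) (x : V ⧸ corootLattice P) :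
    weightChar P μ (w • x) = weightChar P (smulWeight P w⁻¹ μ) x := by
  induction x using QuotientAddGroup.induction_on with
  | H x =>
    change Complex.exp (2 * Real.pi * Complex.I * (⟪(μ : V), w • x⟫ : ℝ)) =
      Complex.exp (2 * Real.pi * Complex.I * (⟪w⁻¹ • (μ : V), x⟫ : ℝ))
    rw [← inner_smul_smul P w (w⁻¹ • (μ : V)), smul_inv_smul]

/-- Moving `w` to the other side of the scalar product reindexes the sum by `u ↦ w⁻¹ u`, which costs
the factor `σ(w)`. -/
theorem torusOrbitFun_smul [Fintype P.weylGroup] (σ : P.weylGroup →* ℤˣ) (μ : weightLattice P)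
    (w : P.weylGroup) (x : V ⧸ corootLattice P) :
    torusOrbitFun P σ μ (w • x) = ((σ w : ℤ) : ℂ) * torusOrbitFun P σ μ x := by
  rw [torusOrbitFun_eq_sum, torusOrbitFun_eq_sum, Finset.mul_sum]
  refine Fintype.sum_equiv (Equiv.mulLeft w⁻¹) _ _ fun u ↦ ?_
  have hw : ((σ w : ℤ) : ℂ) * ((σ w⁻¹ : ℤ) : ℂ) = 1 := by
    rw [← Int.cast_mul, ← Units.val_mul, ← map_mul, mul_inv_cancel, map_one]
    simp
  have hu : smulWeight P w⁻¹ (smulWeight P u μ) = smulWeight P (w⁻¹ * u) μ :=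
    Subtype.ext (mul_smul w⁻¹ u (μ : V)).symm
  rw [weightChar_smul, hu, Equiv.coe_mulLeft, map_mul, Units.val_mul, Int.cast_mul, ← mul_assoc,
    ← mul_assoc, hw, one_mul]

end Characters

/-! ### Sums over the orbits of a finite group -/

/-- The orbits of the points of `X` are disjoint, `F` is constant on each, and `F` vanishes on the
rest of `G`. -/
theorem finsum_mem_card_orbit_mul {W Y : Type*} [Group W] [MulAction W Y]
    (G : Set Y) [Finite G] (hG : ∀ (w : W), ∀ x ∈ G, w • x ∈ G) (X : Set Y) (hX : X ⊆ G)
    (hinj : ∀ x ∈ X, ∀ w : W, w • x ∈ X → w • x = x) (F : Y → ℂ) (hF : ∀ (w : W) x, F (w • x) = F x)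
    (h0 : ∀ x ∈ G, (∀ w : W, w • x ∉ X) → F x = 0) :
    ∑ᶠ x ∈ X, (Nat.card (MulAction.orbit W x) : ℂ) * F x = ∑ᶠ x ∈ G, F x := by
  classical
  have hGf : G.Finite := Set.toFinite G
  have hXf : X.Finite := hGf.subset hX
  have horb : ∀ x ∈ X, MulAction.orbit W x ⊆ G := by
    rintro x hx _ ⟨w, rfl⟩
    exact hG w x (hX hx)
  have hdisj : X.PairwiseDisjoint fun x ↦ MulAction.orbit W x := by
    intro x hx y hy hxy
    refine Set.disjoint_left.mpr fun z hzx hzy ↦ hxy ?_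
    obtain ⟨w, rfl⟩ : x ∈ MulAction.orbit W y := by
      rw [← MulAction.orbit_eq_iff, ← MulAction.orbit_eq_iff.mpr hzx, MulAction.orbit_eq_iff.mpr hzy]
    exact hinj y hy w hx
  have h1 : ∀ x ∈ X, (Nat.card (MulAction.orbit W x) : ℂ) * F x =
      ∑ᶠ y ∈ MulAction.orbit W x, F y := by
    intro x hx
    have hf : (MulAction.orbit W x).Finite := hGf.subset (horb x hx)
    rw [finsum_mem_congr rfl (g := fun _ ↦ F x) (by rintro _ ⟨w, rfl⟩; exact hF w x),
      finsum_mem_eq_finite_toFinset_sum _ hf, Finset.sum_const, nsmul_eq_mul,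
      Nat.card_eq_card_finite_toFinset hf]
  rw [finsum_mem_congr rfl h1, ← finsum_mem_biUnion hdisj hXf fun x hx ↦ hGf.subset (horb x hx)]
  refine finsum_mem_inter_support_eq' _ _ _ fun x hx ↦ ⟨fun h ↦ Set.iUnion₂_subset horb h, fun h ↦ ?_⟩
  by_contra hnot
  refine hx (h0 x h fun w hw ↦ hnot ?_)
  exact Set.mem_iUnion₂.mpr ⟨w • x, hw, w⁻¹, inv_smul_smul w x⟩

/-! ### Discrete orthogonality -/

section Orthogonality

variable [Finite ι] [Nonempty ι] {P : RootPairing ι ℝ V V} (b : P.Base) [P.IsRootSystem]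
  [P.IsCrystallographic] [P.IsReduced] [P.IsIrreducible] [IsEuclidean P] (σ : P.weylGroup →* ℤˣ)

variable {σ} in
theorem sign_eq_one_of_stabilizer {L : AddSubgroup V} [IsWeylStable P L] {a : V}
    (ha : (MulAction.stabilizer (AffineWeylGroup P L) a).map
      (σ.comp SemidirectProduct.rightHom) = ⊥)
    {w : P.weylGroup} {q : V} (hq : q ∈ L) (h : w • a + q = a) : σ w = 1 := by
  have hmem : (⟨Multiplicative.ofAdd ⟨q, hq⟩, w⟩ : AffineWeylGroup P L) ∈
      MulAction.stabilizer (AffineWeylGroup P L) a := h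
  have := Subgroup.mem_map_of_mem (σ.comp SemidirectProduct.rightHom) hmem
  rw [ha, Subgroup.mem_bot] at this
  exact this

variable {σ} in
theorem exists_sign_eq_neg_one {L : AddSubgroup V} [IsWeylStable P L] {a : V}
    (ha : (MulAction.stabilizer (AffineWeylGroup P L) a).map
      (σ.comp SemidirectProduct.rightHom) ≠ ⊥) :
    ∃ w : P.weylGroup, ∃ q ∈ L, w • a + q = a ∧ σ w = -1 := by
  obtain ⟨_, ⟨g, hg, rfl⟩, hne⟩ := (Subgroup.bot_or_exists_ne_one _).resolve_left ha
  exact ⟨g.right, g.left.toAdd, g.left.toAdd.2, hg, (Int.units_eq_one_or _).resolve_left hne⟩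

theorem gridInner_eq_finsum_torusGrid {M : ℕ} (hM : 0 < M) (l l' : weightLattice P) :
    gridInner P (pointGrid P b σ M) (torusOrbitFun P σ l) (torusOrbitFun P σ l') =
      ∑ᶠ x ∈ (torusGrid P M : Set (V ⧸ corootLattice P)),
        torusOrbitFun P σ l x * (starRingEnd ℂ) (torusOrbitFun P σ l' x) := by
  have := Fintype.ofFinite P.weylGroup
  have : Finite (torusGrid P M : Set (V ⧸ corootLattice P)) := finite_torusGrid b hM
  have stable : ∀ (w : P.weylGroup) {a : V}, a ∈ fractionalCoweightLattice P M →
      w • a ∈ fractionalCoweightLattice P M := by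
    intro w a ha y hy
    obtain ⟨k, hk⟩ := ha (w⁻¹ • y) (IsWeylStable.smul_mem w⁻¹ hy)
    refine ⟨k, ?_⟩
    rw [← hk, ← inner_smul_smul P w _ (w⁻¹ • y), smul_inv_smul]
    change ⟪M • w • a, y⟫ = ⟪w • M • a, y⟫
    rw [smul_comm]
  have mk_eq : ∀ (w : P.weylGroup) {q : V}, q ∈ corootLattice P → ∀ a : V,
      ((w • a + q : V) : V ⧸ corootLattice P) = w • (a : V ⧸ corootLattice P) := by
    intro w q hq a
    rw [QuotientAddGroup.mk_add, (QuotientAddGroup.eq_zero_iff q).mpr hq, add_zero]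
    rfl
  simp only [gridInner, mul_assoc]
  refine finsum_mem_card_orbit_mul (torusGrid P M : Set (V ⧸ corootLattice P)) ?_
    (pointGrid P b σ M) ?_ ?_ (fun x ↦ torusOrbitFun P σ l x *
      (starRingEnd ℂ) (torusOrbitFun P σ l' x)) ?_ ?_
  · rintro w _ ⟨a, ha, rfl⟩
    exact ⟨w • a, stable w ha, rfl⟩
  · rintro _ ⟨a, -, ha, rfl⟩
    exact ⟨a, ha, rfl⟩
  · rintro _ ⟨a, ha, -, rfl⟩ w ⟨a', ha', -, h⟩
    have hq : -(w • a) + a' ∈ corootLattice P := QuotientAddGroup.eq.mp h.symm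
    have heq : w • a + (-(w • a) + a') = a := eq_of_mem_fundamentalDomain b w hq ha.1 (by
      rw [add_neg_cancel_left]; exact ha'.1)
    rw [← h, ← heq, add_neg_cancel_left]
  · intro w x
    simp only [torusOrbitFun_smul, map_mul]
    have hw : ((σ w : ℤ) : ℂ) * ((σ w : ℤ) : ℂ) = 1 := by
      rw [← Int.cast_mul, ← Units.val_mul, Int.units_mul_self]
      simp
    rw [map_intCast, mul_mul_mul_comm, hw, one_mul]
  · rintro _ ⟨a, ha, rfl⟩ hnot
    obtain ⟨w, q, hq, hmem⟩ := exists_mem_fundamentalDomain b a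
    have hgrid : w • a + q ∈ fractionalCoweightLattice P M :=
      add_mem (stable w ha) (corootLattice_le_fractionalCoweightLattice M hq)
    have hne : (MulAction.stabilizer (AffineWeylGroup P (corootLattice P)) (w • a + q)).map
        (σ.comp SemidirectProduct.rightHom) ≠ ⊥ := fun h ↦
      hnot w ⟨w • a + q, ⟨hmem, h⟩, hgrid, mk_eq w hq a⟩
    -- The representative in `F` misses the signed domain, so some `u` with `σ(u) = -1` fixes its
    -- coset and `φ = -φ` there.
    obtain ⟨u, r, hr, hfix, hu⟩ := exists_sign_eq_neg_one hne
    have h1 : u • w • (a : V ⧸ corootLattice P) = w • (a : V ⧸ corootLattice P) := by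
      rw [← mk_eq w hq, ← mk_eq u hr, hfix]
    have h2 := torusOrbitFun_smul P σ l u (w • (a : V ⧸ corootLattice P))
    rw [h1, torusOrbitFun_smul, hu] at h2
    have hw0 : ((σ w : ℤ) : ℂ) ≠ 0 := by exact_mod_cast (σ w).ne_zero
    have h3 : ((σ w : ℤ) : ℂ) * torusOrbitFun P σ l (a : V ⧸ corootLattice P) = 0 := by
      push_cast at h2
      linear_combination h2 / 2
    change torusOrbitFun P σ l (a : V ⧸ corootLattice P) * _ = 0
    rw [(mul_eq_zero.mp h3).resolve_left hw0, zero_mul]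

variable {σ} in
-- Dividing by `M` turns `u λ = λ'` into `u a + q = a'` with `q ∈ Q` and `a, a' ∈ F^∨`. Strictness
-- of `F^∨` gives `a' = a`, so `(q, u)` stabilizes `a`.
theorem eq_and_sign_eq_one_of_mem_weightGrid {M : ℕ} (hM : 0 < M) {l l' : V}
    (hl : (l : V ⧸ scaledRootLattice P M) ∈ weightGrid P b σ M)
    (hl' : (l' : V ⧸ scaledRootLattice P M) ∈ weightGrid P b σ M) (u : P.weylGroup)
    (h : u • (l : V ⧸ scaledRootLattice P M) = (l' : V ⧸ scaledRootLattice P M)) :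
    (l : V ⧸ scaledRootLattice P M) = (l' : V ⧸ scaledRootLattice P M) ∧ σ u = 1 := by
  obtain ⟨a, ⟨ha, hstab⟩, -, hal⟩ := hl
  obtain ⟨a', ⟨ha', -⟩, -, hal'⟩ := hl'
  rw [← hal, ← hal'] at h ⊢
  obtain ⟨q, hq, hqe⟩ : -(u • (M • a)) + M • a' ∈ scaledRootLattice P M :=
    QuotientAddGroup.eq.mp h
  have hqa : u • a + q = a' := by
    have h0 : M • (u • a + q - a') = 0 := by
      have hqe' : M • q = -(u • (M • a)) + M • a' := hqe
      rw [smul_sub, smul_add, hqe', smul_comm M u a]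
      abel
    have : IsAddTorsionFree V := .of_isTorsionFree ℝ V
    exact sub_eq_zero.mp ((nsmul_eq_zero_iff_right hM.ne').mp h0)
  have hfix := eq_of_mem_dualFundamentalDomain b u hq ha (hqa ▸ ha')
  exact ⟨by rw [← hqa, hfix], sign_eq_one_of_stabilizer hstab hq hfix⟩

/-- Discrete orthogonality for an arbitrary sign homomorphism of the Weyl group. -/
theorem gridInner_torusOrbitFun [DecidableEq b.support] {M : ℕ} (hM : 0 < M)
    (l l' : weightLattice P)
    [Decidable (((l : V) : V ⧸ scaledRootLattice P M) = ((l' : V) : V ⧸ scaledRootLattice P M))]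
    (hl : ((l : V) : V ⧸ scaledRootLattice P M) ∈ weightGrid P b σ M)
    (hl' : ((l' : V) : V ⧸ scaledRootLattice P M) ∈ weightGrid P b σ M) :
    gridInner P (pointGrid P b σ M) (torusOrbitFun P σ l) (torusOrbitFun P σ l') =
      (b.cartanMatrix.det : ℂ) * (Nat.card P.weylGroup : ℂ) * (M : ℂ) ^ finrank ℝ V *
        (dualStabSize P ((l : V) : V ⧸ scaledRootLattice P M) : ℂ) *
        (if ((l : V) : V ⧸ scaledRootLattice P M) = ((l' : V) : V ⧸ scaledRootLattice P M)
          then 1 else 0) := by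
  classical
  have := Fintype.ofFinite P.weylGroup
  have := finite_torusGrid b hM
  have := Fintype.ofFinite (torusGrid P M)
  let C : P.weylGroup → Prop := fun u ↦
    u • ((l : V) : V ⧸ scaledRootLattice P M) = ((l' : V) : V ⧸ scaledRootLattice P M)
  have hmem : ∀ w u, ((smulWeight P (w * u) l - smulWeight P w l' : weightLattice P) : V) ∈
      scaledRootLattice P M ↔ C u := by
    intro w u
    have h1 : ((smulWeight P (w * u) l - smulWeight P w l' : weightLattice P) : V) =
        (w * u) • (l : V) - w • (l' : V) := rfl
    rw [h1, ← neg_mem_iff, neg_sub, sub_eq_neg_add, ← QuotientAddGroup.eq]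
    change (w * u) • ((l : V) : V ⧸ scaledRootLattice P M) =
      w • ((l' : V) : V ⧸ scaledRootLattice P M) ↔ _
    rw [mul_smul, smul_left_cancel_iff]
  have hsum : ∑ x : torusGrid P M, torusOrbitFun P σ l x *
      (starRingEnd ℂ) (torusOrbitFun P σ l' x) =
      ∑ _w : P.weylGroup, ∑ u : P.weylGroup, if C u then (Nat.card (torusGrid P M) : ℂ) else 0 := by
    simp only [torusOrbitFun_eq_sum, map_sum, Finset.sum_mul_sum]
    rw [Finset.sum_comm]
    conv_lhs => enter [2, w]; rw [Finset.sum_comm]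
    rw [Finset.sum_comm]
    refine Finset.sum_congr rfl fun w _ ↦ ?_
    -- Index the first factor by `w u`: the survival condition becomes `u λ = λ'`, independent of
    -- `w`, and the sign `σ(w u) σ(w)` becomes `σ(u)`.
    refine (Fintype.sum_equiv (Equiv.mulLeft w) _ _ fun u ↦ ?_).symm
    have hterm : ∀ x : torusGrid P M,
        ((σ (w * u) : ℤ) : ℂ) * weightChar P (smulWeight P (w * u) l) x *
          (starRingEnd ℂ) (((σ w : ℤ) : ℂ) * weightChar P (smulWeight P w l') x) =
        ((σ (w * u) * σ w : ℤˣ) : ℤ) *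
          weightChar P (smulWeight P (w * u) l - smulWeight P w l') x := by
      intro x
      rw [← weightChar_mul_conj, (starRingEnd ℂ).map_mul, map_intCast]
      push_cast
      ring
    rw [Equiv.coe_mulLeft, Finset.sum_congr rfl fun x _ ↦ hterm x, ← Finset.mul_sum,
      sum_weightChar b hM, if_congr (hmem w u) rfl rfl]
    split_ifs with hC
    · have hu := (eq_and_sign_eq_one_of_mem_weightGrid b hM hl hl' u hC).2
      rw [map_mul, hu, mul_one, Int.units_mul_self]
      simp
    · rw [mul_zero]
  have hcount : ∑ u : P.weylGroup, (if C u then (Nat.card (torusGrid P M) : ℂ) else 0) =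
      Nat.card (torusGrid P M) * dualStabSize P ((l : V) : V ⧸ scaledRootLattice P M) *
        (if ((l : V) : V ⧸ scaledRootLattice P M) = ((l' : V) : V ⧸ scaledRootLattice P M)
          then 1 else 0) := by
    -- For `λ = λ'` the surviving `u` form the stabilizer of `λ`; otherwise there are none.
    split_ifs with heq
    · have hset : dualStabSize P ((l : V) : V ⧸ scaledRootLattice P M) =
          (Finset.univ.filter C).card := by
        rw [dualStabSize, Nat.card_eq_fintype_card, Fintype.card_subtype]
        refine congrArg Finset.card (Finset.filter_congr fun u _ ↦ ?_)
        rw [MulAction.mem_stabilizer_iff]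
        simp only [C, ← heq]
      rw [← Finset.sum_filter, Finset.sum_const, nsmul_eq_mul, hset, mul_one, mul_comm]
    · rw [mul_zero]
      exact Finset.sum_eq_zero fun u _ ↦ if_neg fun hC ↦
        heq (eq_and_sign_eq_one_of_mem_weightGrid b hM hl hl' u hC).1
  have hcard : (Nat.card (torusGrid P M) : ℂ) = b.cartanMatrix.det * (M : ℂ) ^ finrank ℝ V := by
    exact_mod_cast congrArg (Int.cast : ℤ → ℂ) (card_torusGrid b hM)
  rw [gridInner_eq_finsum_torusGrid b σ hM, ← finsum_set_coe_eq_finsum_mem, finsum_eq_sum_of_fintype]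
  refine hsum.trans ?_
  rw [Finset.sum_congr rfl fun _ _ ↦ hcount, Finset.sum_const, nsmul_eq_mul, Finset.card_univ,
    ← Nat.card_eq_fintype_card, hcard]
  ring

end Orthogonality

end OrbitFunctions

end

/-! ### The short and the long sign homomorphism -/

open OrbitFunctions in
open scoped Classical in
theorem mainTheorem1 {ι V : Type*} [Finite ι] [Nonempty ι]
    [NormedAddCommGroup V] [InnerProductSpace ℝ V]
    (P : RootPairing ι ℝ V V) [P.IsRootSystem] [P.IsCrystallographic] [P.IsReduced]
    [P.IsIrreducible] [IsEuclidean P]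
    (htwo : ∃ i j, ‖P.root i‖ ≠ ‖P.root j‖)
    (b : P.Base) (M : ℕ) (hM : 0 < M) :
    (∀ l l' : weightLattice P,
      ((l : V) : V ⧸ scaledRootLattice P M) ∈ weightGrid P b (shortSign P b) M →
      ((l' : V) : V ⧸ scaledRootLattice P M) ∈ weightGrid P b (shortSign P b) M →
      gridInner P (pointGrid P b (shortSign P b) M)
          (torusOrbitFun P (shortSign P b) l) (torusOrbitFun P (shortSign P b) l') =
        (b.cartanMatrix.det : ℂ) * (Nat.card P.weylGroup : ℂ) *
          (M : ℂ) ^ Module.finrank ℝ V *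
          (dualStabSize P ((l : V) : V ⧸ scaledRootLattice P M) : ℂ) *
          (if ((l : V) : V ⧸ scaledRootLattice P M) = ((l' : V) : V ⧸ scaledRootLattice P M)
            then 1 else 0)) ∧
    (∀ l l' : weightLattice P,
      ((l : V) : V ⧸ scaledRootLattice P M) ∈ weightGrid P b (longSign P b) M →
      ((l' : V) : V ⧸ scaledRootLattice P M) ∈ weightGrid P b (longSign P b) M →
      gridInner P (pointGrid P b (longSign P b) M)
          (torusOrbitFun P (longSign P b) l) (torusOrbitFun P (longSign P b) l') =
        (b.cartanMatrix.det : ℂ) * (Nat.card P.weylGroup : ℂ) *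
          (M : ℂ) ^ Module.finrank ℝ V *
          (dualStabSize P ((l : V) : V ⧸ scaledRootLattice P M) : ℂ) *
          (if ((l : V) : V ⧸ scaledRootLattice P M) = ((l' : V) : V ⧸ scaledRootLattice P M)
            then 1 else 0)) := by
  exact ⟨fun l l' hl hl' ↦ gridInner_torusOrbitFun b (shortSign P b) hM l l' hl hl',
    fun l l' hl hl' ↦ gridInner_torusOrbitFun b (longSign P b) hM l l' hl hl'⟩
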